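/- Let $g\in C^2(\mathbb R)$ be bounded and strictly increasing with $g(0)=0$, strictly concave on $(0,+\infty)$ and strictly convex on $(-\infty,0)$; put $g_\pm=\lim_{s\to\pm\infty}g(s)$ and $G(s)=\int_0^s g$. Say that $q\in L^\infty(\mathbb R)$ has asymptotic average $A$ if $\frac1T\int_t^{t+T}q\to A$ as $T\to+\infty$, uniformly in $t\in\mathbb R$. Let $p:\mathbb R\to\mathbb R$ be bounded and continuous with asymptotic average $A(p)$, where $g_-<A(p)<g_+$. For $q\in L^\infty(\mathbb R)$ and $\varepsilon\in(0,1)$, an $\varepsilon$-decomposition of $q$ is an identity $q=q_1+\dot q_2$ (weak derivative) with $q_1,q_2\in L^\infty(\mathbb R)$ and $\|q_1-A(p)\|_\infty<\varepsilon/2$. Then $p$ has an $\varepsilon$-decomposition for every $\varepsilon\in(0,1)$. Fix any choice $p=p_{1,\varepsilon}+\dot p_{2,\varepsilon}$, $\varepsilon\in(0,1)$, of such decompositions, and let $\mathcal P$ be the set of all $q\in L^\infty(\mathbb R)$ with $\|q\|_\infty<\|p\|_\infty+1$ and asymptotic average $A(p)$ which for every $\varepsilon\in(0,1)$ have an $\varepsilon$-decomposition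 $q=q_{1,\varepsilon}+\dot q_{2,\varepsilon}$ with $\|q_{2,\varepsilon}\|_\infty<\|p_{2,\varepsilon}\|_\infty+1$. For $a<b$ and $q\in\mathcal P$ consider $$J_{(a,b),q}(u)=\int_a^b\Big[\tfrac12\dot u^2(t)-G(u(t))+q(t)u(t)\Big]\,dt\qquad\text{on } H^1_0(a,b)^+=\{u\in H^1_0(a,b):u\ge0\}.$$ There is $\tilde L>0$ such that (T) for all $a,b$ with $b-a\ge\tilde L$ and all $q\in\mathcal P$, every minimizer of $J_{(a,b),q}$ in $H^1_0(a,b)^+$ is strictly positive in $(a,b)$. Moreover, for every $\tilde L>0$ satisfying (T) and all $a,b$ with $b-a\ge\tilde L$: the functional $J_{(a,b),p}$ has exactly one minimizer $u=u(\cdot\,;a,b;p)$ in $H^1_0(a,b)^+$; $u$ is a classical solution of $\ddot u+g(u)=p$ in $(a,b)$, $u(a)=0=u(b)$, $u>0$ in $(a,b)$; and $u$ is non-degenerate, that is, the linearized Dirichlet problem $$\ddot\psi(t)+g'(u(t))\psi(t)=0\ \text{ in }(a,b),\qquad \psi(a)=0=\psi(b),$$ has only the trivial solution $\psi\equiv0$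 in $H^2(a,b)\cap H^1_0(a,b)$. -/

import Mathlib

open Set Filter Topology MeasureTheory
open scoped ENNReal

namespace DualNehari

/-- Hypotheses on the nonlinearity: `g(0) = 0`, `g` is `C²`, bounded, strictly increasing,
strictly concave on `(0,∞)` and strictly convex on `(-∞,0)`. -/
structure IsSaturating (g : ℝ → ℝ) : Prop where
  zero : g 0 = 0
  contDiff : ContDiff ℝ 2 g
  bounded : ∃ C : ℝ, ∀ s, |g s| ≤ C
  strictMono : StrictMono g
  strictConcave : StrictConcaveOn ℝ (Ioi 0) g
  strictConvex : StrictConvexOn ℝ (Iio 0) g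

/-- `q` has asymptotic average `A`: the means over `(t, t + T)` converge to `A` as `T → ∞`,
uniformly in `t`. -/
def HasAsymptoticAverage (q : ℝ → ℝ) (A : ℝ) : Prop :=
  TendstoUniformly (fun T t : ℝ => (1 / T) * ∫ s in t..(t + T), q s) (fun _ => A) atTop

/-- `q = q₁ + q̇₂` with `q₁, q₂ ∈ L^∞(ℝ)` and `‖q₁ - A‖_∞ < ε / 2`. As `q̇₂ = q - q₁` is bounded,
`q₂` is taken to be its Lipschitz representative, and `q̇₂` is the weak derivative. -/
structure IsDecomposition (q : ℝ → ℝ) (A ε : ℝ) (q₁ q₂ : ℝ → ℝ) : Prop where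
  memLp_fst : MemLp q₁ ∞ volume
  memLp_snd : MemLp q₂ ∞ volume
  close : eLpNorm (fun t => q₁ t - A) ∞ volume < ENNReal.ofReal (ε / 2)
  primitive : ∀ s t : ℝ, q₂ t - q₂ s = ∫ x in s..t, (q x - q₁ x)

/-- A choice, for every `ε ∈ (0,1)`, of a decomposition of `p`. -/
def IsDecompositionFamily (p : ℝ → ℝ) (A : ℝ) (p₁ p₂ : ℝ → ℝ → ℝ) : Prop :=
  ∀ ε ∈ Ioo (0 : ℝ) 1, IsDecomposition p A ε (p₁ ε) (p₂ ε)

/-- The class `𝒫` of forcing terms attached to `p`, its average `A`, and the chosen bounded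
parts `p₂ ε`; here `M₁ = ‖p‖_∞ + 1` and `M_ε = ‖p₂ ε‖_∞ + 1`. -/
def forcingClass (p : ℝ → ℝ) (A : ℝ) (p₂ : ℝ → ℝ → ℝ) : Set (ℝ → ℝ) :=
  {q | MemLp q ∞ volume ∧ eLpNorm q ∞ volume < eLpNorm p ∞ volume + 1 ∧
    HasAsymptoticAverage q A ∧
    ∀ ε ∈ Ioo (0 : ℝ) 1, ∃ q₁ q₂ : ℝ → ℝ, IsDecomposition q A ε q₁ q₂ ∧
      eLpNorm q₂ ∞ volume < eLpNorm (p₂ ε) ∞ volume + 1}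

/-- `H¹(a,b)`, through continuous representatives on `[a,b]`: absolutely continuous functions
whose derivative is square integrable. -/
def MemH1 (a b : ℝ) (u : ℝ → ℝ) : Prop :=
  AbsolutelyContinuousOnInterval u a b ∧ MemLp (deriv u) 2 (volume.restrict (Ioo a b))

/-- `H¹₀(a,b)`. -/
def MemH10 (a b : ℝ) (u : ℝ → ℝ) : Prop :=
  MemH1 a b u ∧ u a = 0 ∧ u b = 0

/-- `H²(a,b)`: continuous on `[a,b]`, and the derivative in `(a,b)` extends to a function
of class `H¹`. -/
def MemH2 (a b : ℝ) (u : ℝ → ℝ) : Prop :=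
  ContinuousOn u (Icc a b) ∧ ∃ w : ℝ → ℝ, MemH1 a b w ∧ ∀ t ∈ Ioo a b, HasDerivAt u (w t) t

/-- The cone `H¹₀(a,b)⁺`. -/
def H10plus (a b : ℝ) : Set (ℝ → ℝ) :=
  {u | MemH10 a b u ∧ ∀ t ∈ Icc a b, 0 ≤ u t}

/-- The action functional `∫ₐᵇ (u̇² / 2 - G(u) + q u)`, where `G(s) = ∫₀ˢ g`. -/
noncomputable def action (g q : ℝ → ℝ) (a b : ℝ) (u : ℝ → ℝ) : ℝ :=
  ∫ t in a..b, ((1 / 2) * (deriv u t) ^ 2 - (∫ s in (0 : ℝ)..(u t), g s) + q t * u t)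

/-- `u` minimizes the action in `H¹₀(a,b)⁺`. -/
def IsNonnegMinimizer (g q : ℝ → ℝ) (a b : ℝ) (u : ℝ → ℝ) : Prop :=
  u ∈ H10plus a b ∧ ∀ v ∈ H10plus a b, action g q a b u ≤ action g q a b v

/-- `L` is a threshold length for the class `𝒬` of forcing terms: on every interval of length
at least `L`, for every forcing term in `𝒬`, all nonnegative minimizers are positive inside. -/
def IsThreshold (g : ℝ → ℝ) (𝒬 : Set (ℝ → ℝ)) (L : ℝ) : Prop :=
  0 < L ∧ ∀ a b : ℝ, L ≤ b - a → ∀ q ∈ 𝒬, ∀ u : ℝ → ℝ, IsNonnegMinimizer g q a b u →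
    ∀ t ∈ Ioo a b, 0 < u t

/-- `u` is a classical solution of `ü + g(u) = p` in `(a,b)`, `u(a) = 0 = u(b)`, `u > 0` in
`(a,b)`. -/
def SolvesPositiveBVP (g p : ℝ → ℝ) (a b : ℝ) (u : ℝ → ℝ) : Prop :=
  ContinuousOn u (Icc a b) ∧ ContDiffOn ℝ 2 u (Ioo a b) ∧
    (∀ t ∈ Ioo a b, deriv (deriv u) t + g (u t) = p t) ∧
    u a = 0 ∧ u b = 0 ∧ ∀ t ∈ Ioo a b, 0 < u t

/-- `u` is non-degenerate: the linearized Dirichlet problem `ψ̈ + g'(u) ψ = 0` has only the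
trivial solution in `H²(a,b) ∩ H¹₀(a,b)`. -/
def IsNondegenerate (g : ℝ → ℝ) (a b : ℝ) (u : ℝ → ℝ) : Prop :=
  ∀ ψ : ℝ → ℝ, MemH2 a b ψ → MemH10 a b ψ →
    (∀ᵐ t ∂(volume.restrict (Ioo a b)), deriv (deriv ψ) t + deriv g (u t) * ψ t = 0) →
    ∀ t ∈ Icc a b, ψ t = 0

end DualNehari

open DualNehari

/-!
Let `κ = g₊ - A(p) > 0`. On an interval between two zeros of length `d` a minimizer `u` has size
`d²`, so that `G(u)` may be replaced by `g₊ u`; integrating by parts in a decomposition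
`q = q₁ + q̇₂` shows that the oscillating part of the force contributes a lower order term,
uniformly for `q ∈ 𝒫`. Hence the action is, up to `o(d³)`, the strictly convex functional
`∫ (u̇² / 2 - κ u)`, and `u` is within `o(d²)` of its minimizer, the parabola
`κ (t - α) (β - t) / 2`. On the other hand, first variations in nonnegative directions give `ü ≤ K`
weakly on the whole interval, which makes a minimizer at most quadratic, `u(t) ≤ 2 K (t - m)²`,
around an interior zero `m`. The parabola on the longer of the two sides of `m` grows linearly from
`m`, so there is no such zero on long intervals.

For uniqueness and nondegeneracy, the class `𝒫` also contains, for small `δ > 0`, a force equal to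
`p + δ` on `[a,b]`, which has a positive minimizer `v`. Comparing actions gives `v ≤ u` for every
minimizer `u` for `p`, and by concavity of `g` the difference `w = u - v` is a strict supersolution,
`ẅ + g'(u) w ≤ -δ`; the same holds with `g'(u)` replaced by the secant slope of `g` between `u` and
a second minimizer for `p`, wherever the latter is larger. A solution `ψ` of the linearized
problem, or the difference of two minimizers for `p`, is therefore excluded by Sturm comparison with
`w` on an interval where it is positive.
-/

namespace DualNehari

section L2Deriv

variable {a b : ℝ} {u f v h : ℝ → ℝ}

/-- `u` is absolutely continuous on `[a,b]` with square integrable derivative `f`. Naming the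
derivative allows `f` to be changed on null sets, unlike `deriv u`. -/
structure HasL2Deriv (a b : ℝ) (u f : ℝ → ℝ) : Prop where
  memLp : MemLp f 2 (volume.restrict (Ioo a b))
  eq_integral : ∀ t ∈ Icc a b, u t = u a + ∫ s in a..t, f s

namespace HasL2Deriv

theorem intervalIntegrable (hu : HasL2Deriv a b u f) {s t : ℝ} (hs : s ∈ Icc a b)
    (ht : t ∈ Icc a b) : IntervalIntegrable f volume s t := by
  have hab : a ≤ b := hs.1.trans hs.2
  have hf : IntervalIntegrable f volume a b :=
    (intervalIntegrable_iff_integrableOn_Ioo_of_le hab).2 (hu.memLp.integrable (by norm_num))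
  exact hf.mono_set (by rw [uIcc_of_le hab]; exact uIcc_subset_Icc hs ht)

theorem intervalIntegrable_deriv (hu : HasL2Deriv a b u f) (hab : a ≤ b) :
    IntervalIntegrable f volume a b :=
  hu.intervalIntegrable (left_mem_Icc.2 hab) (right_mem_Icc.2 hab)

theorem sub_eq_integral (hu : HasL2Deriv a b u f) {s t : ℝ} (hs : s ∈ Icc a b)
    (ht : t ∈ Icc a b) : u t - u s = ∫ x in s..t, f x := by
  have ha : a ∈ Icc a b := ⟨le_rfl, hs.1.trans hs.2⟩
  rw [hu.eq_integral t ht, hu.eq_integral s hs,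
    ← intervalIntegral.integral_interval_sub_left (hu.intervalIntegrable ha ht)
      (hu.intervalIntegrable ha hs)]
  ring

theorem mono (hu : HasL2Deriv a b u f) {α β : ℝ} (hα : a ≤ α) (hβ : β ≤ b) :
    HasL2Deriv α β u f where
  memLp := hu.memLp.mono_measure (Measure.restrict_mono (Ioo_subset_Ioo hα hβ) le_rfl)
  eq_integral t ht := by
    rw [← hu.sub_eq_integral ⟨hα, ht.1.trans (ht.2.trans hβ)⟩ ⟨hα.trans ht.1, ht.2.trans hβ⟩]
    ring

theorem congr (hu : HasL2Deriv a b u f) (huv : EqOn v u (Icc a b)) (hfh : EqOn h f (Ioo a b)) :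
    HasL2Deriv a b v h where
  memLp := hu.memLp.ae_eq <| (ae_restrict_mem measurableSet_Ioo).mono fun t ht => (hfh ht).symm
  eq_integral t ht := by
    rw [huv ht, huv ⟨le_rfl, ht.1.trans ht.2⟩, hu.eq_integral t ht,
      intervalIntegral.integral_congr_Ioo_of_le ht.1 (hfh.mono (Ioo_subset_Ioo_right ht.2))]

theorem concat {c : ℝ} (hac : a ≤ c) (hcb : c ≤ b) (h₁ : HasL2Deriv a c u f)
    (h₂ : HasL2Deriv c b u f) : HasL2Deriv a b u f where
  memLp := by
    have hl : MemLp f 2 (volume.restrict (Ioc a c)) := by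
      rw [← restrict_Ioo_eq_restrict_Ioc]; exact h₁.memLp
    have hr : MemLp f 2 (volume.restrict (Ioc c b)) := by
      rw [← restrict_Ioo_eq_restrict_Ioc]; exact h₂.memLp
    have hm := aestronglyMeasurable_union_iff.2 ⟨hl.aestronglyMeasurable, hr.aestronglyMeasurable⟩
    rw [restrict_Ioo_eq_restrict_Ioc, ← Ioc_union_Ioc_eq_Ioc hac hcb,
      memLp_two_iff_integrable_sq hm]
    exact IntegrableOn.union hl.integrable_sq hr.integrable_sq
  eq_integral t ht := by
    rcases le_total t c with htc | hct
    · exact h₁.eq_integral t ⟨ht.1, htc⟩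
    · rw [h₂.eq_integral t ⟨hct, ht.2⟩, h₁.eq_integral c ⟨hac, le_rfl⟩, add_assoc,
        intervalIntegral.integral_add_adjacent_intervals (h₁.intervalIntegrable_deriv hac)
          (h₂.intervalIntegrable ⟨le_rfl, hcb⟩ ⟨hct, ht.2⟩)]

theorem continuousOn (hu : HasL2Deriv a b u f) : ContinuousOn u (Icc a b) := by
  rcases le_or_gt a b with hab | hab
  · have hF := intervalIntegral.continuousOn_primitive_interval
      ((intervalIntegrable_iff' (by simp)).1 (hu.intervalIntegrable_deriv hab))
    rw [uIcc_of_le hab] at hF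
    exact (continuousOn_const.add hF).congr hu.eq_integral
  · simp [Icc_eq_empty hab.not_ge]

theorem absolutelyContinuousOnInterval (hu : HasL2Deriv a b u f) (hab : a ≤ b) :
    AbsolutelyContinuousOnInterval u a b := by
  have hprim := ((LipschitzWith.const (u a)).lipschitzOnWith).absolutelyContinuousOnInterval.add
    ((hu.intervalIntegrable_deriv hab).absolutelyContinuousOnInterval_intervalIntegral (c := a)
      left_mem_uIcc)
  rw [absolutelyContinuousOnInterval_iff] at hprim ⊢
  intro ε hε
  obtain ⟨δ, hδ, hsum⟩ := hprim ε hε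
  refine ⟨δ, hδ, fun E hE hlen =>
    (Finset.sum_congr rfl fun i hi => ?_).trans_lt (hsum E hE hlen)⟩
  have hmem := hE.1 i hi
  rw [uIcc_of_le hab] at hmem
  simp only [Pi.add_apply]
  rw [hu.eq_integral _ hmem.1, hu.eq_integral _ hmem.2]

theorem deriv_ae_eq (hu : HasL2Deriv a b u f) (hab : a ≤ b) :
    deriv u =ᵐ[volume.restrict (Ioo a b)] f := by
  rw [Filter.EventuallyEq, ae_restrict_iff' measurableSet_Ioo]
  filter_upwards [(hu.intervalIntegrable_deriv hab).ae_hasDerivAt_integral] with x hx hxab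
  have hprim := hx (by rw [uIcc_of_le hab]; exact Ioo_subset_Icc_self hxab) a left_mem_uIcc
  refine ((hprim.const_add (u a)).congr_of_eventuallyEq ?_).deriv
  filter_upwards [Ioo_mem_nhds hxab.1 hxab.2] with y hy
  exact hu.eq_integral y (Ioo_subset_Icc_self hy)

theorem memH1 (hu : HasL2Deriv a b u f) (hab : a ≤ b) : MemH1 a b u :=
  ⟨hu.absolutelyContinuousOnInterval hab, hu.memLp.ae_eq (hu.deriv_ae_eq hab).symm⟩

theorem of_memH1 (hu : MemH1 a b u) (hab : a ≤ b) : HasL2Deriv a b u (deriv u) where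
  memLp := hu.2
  eq_integral t ht := by
    have hac := hu.1.mono (c := a) (d := t) (by
      rw [uIcc_of_le hab, uIcc_of_le ht.1]; exact Icc_subset_Icc le_rfl ht.2)
    rw [hac.integral_deriv_eq_sub]
    ring

theorem integral_comp_deriv_eq (hu : HasL2Deriv a b u f) (hab : a ≤ b) (F : ℝ → ℝ → ℝ) :
    ∫ t in a..b, F t (deriv u t) = ∫ t in a..b, F t (f t) := by
  refine intervalIntegral.integral_congr_ae_restrict ?_
  rw [uIoc_of_le hab, ← restrict_Ioo_eq_restrict_Ioc]
  filter_upwards [hu.deriv_ae_eq hab] with t ht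
  rw [ht]

theorem add (hu : HasL2Deriv a b u f) (hv : HasL2Deriv a b v h) :
    HasL2Deriv a b (fun t => u t + v t) (fun t => f t + h t) where
  memLp := hu.memLp.add hv.memLp
  eq_integral t ht := by
    have ha : a ∈ Icc a b := ⟨le_rfl, ht.1.trans ht.2⟩
    rw [intervalIntegral.integral_add (hu.intervalIntegrable ha ht) (hv.intervalIntegrable ha ht),
      hu.eq_integral t ht, hv.eq_integral t ht]
    ring

theorem const_mul (hu : HasL2Deriv a b u f) (c : ℝ) :
    HasL2Deriv a b (fun t => c * u t) (fun t => c * f t) where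
  memLp := hu.memLp.const_mul c
  eq_integral t ht := by
    rw [intervalIntegral.integral_const_mul, hu.eq_integral t ht]
    ring

theorem sub (hu : HasL2Deriv a b u f) (hv : HasL2Deriv a b v h) :
    HasL2Deriv a b (fun t => u t - v t) (fun t => f t - h t) :=
  (hu.add (hv.const_mul (-1))).congr (fun t _ => by ring) (fun t _ => by ring)

theorem of_hasDerivAt (hu : ContinuousOn u (Icc a b)) (hf : ContinuousOn f (Icc a b))
    (hd : ∀ t ∈ Ioo a b, HasDerivAt u (f t) t) : HasL2Deriv a b u f where
  memLp := by
    obtain ⟨C, hC⟩ := isCompact_Icc.exists_bound_of_continuousOn hf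
    exact MemLp.of_bound ((hf.mono Ioo_subset_Icc_self).aestronglyMeasurable measurableSet_Ioo) C
      ((ae_restrict_mem measurableSet_Ioo).mono fun t ht => hC t (Ioo_subset_Icc_self ht))
  eq_integral t ht := by
    rw [intervalIntegral.integral_eq_sub_of_hasDerivAt_of_le ht.1
      (hu.mono (Icc_subset_Icc le_rfl ht.2)) (fun x hx => hd x ⟨hx.1, hx.2.trans_le ht.2⟩)
      ((hf.mono (by rw [uIcc_of_le ht.1]; exact Icc_subset_Icc le_rfl ht.2)).intervalIntegrable)]
    ring

theorem intervalIntegrable_mul (hu : HasL2Deriv a b u f) (hv : HasL2Deriv a b v h) (hab : a ≤ b) :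
    IntervalIntegrable (fun t => f t * h t) volume a b :=
  (intervalIntegrable_iff_integrableOn_Ioo_of_le hab).2 (hu.memLp.integrable_mul hv.memLp)

theorem intervalIntegrable_sq (hu : HasL2Deriv a b u f) (hab : a ≤ b) :
    IntervalIntegrable (fun t => f t ^ 2) volume a b :=
  (intervalIntegrable_iff_integrableOn_Ioo_of_le hab).2 hu.memLp.integrable_sq

theorem integral_mul_deriv_eq (hu : HasL2Deriv a b u f) (hv : HasL2Deriv a b v h) (hab : a ≤ b) :
    ∫ t in a..b, u t * h t = u b * v b - u a * v a - ∫ t in a..b, f t * v t := by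
  rw [← hv.integral_comp_deriv_eq hab fun t y => u t * y,
    ← hu.integral_comp_deriv_eq hab fun t y => y * v t]
  exact (hu.absolutelyContinuousOnInterval hab).integral_mul_deriv_eq_deriv_mul
    (hv.absolutelyContinuousOnInterval hab)

theorem integral_abs_deriv_le (hu : HasL2Deriv a b u f) (hab : a ≤ b) {c : ℝ} (hc : 0 < c) :
    ∫ t in a..b, |f t| ≤ (c * (b - a) + (∫ t in a..b, f t ^ 2) / c) / 2 := by
  have hsq := hu.intervalIntegrable_sq hab
  have young : ∀ y : ℝ, |y| ≤ c / 2 + 1 / (2 * c) * y ^ 2 := fun y => by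
    have h0 : 0 ≤ (|y| - c) ^ 2 / (2 * c) := by positivity
    have h1 : (|y| - c) ^ 2 / (2 * c) = c / 2 + 1 / (2 * c) * y ^ 2 - |y| := by
      rw [sub_sq, sq_abs]; field_simp; ring
    linarith
  calc ∫ t in a..b, |f t| ≤ ∫ t in a..b, (c / 2 + 1 / (2 * c) * f t ^ 2) :=
        intervalIntegral.integral_mono_on hab (hu.intervalIntegrable_deriv hab).abs
          (intervalIntegrable_const.add (hsq.const_mul _)) fun t _ => young (f t)
    _ = (c * (b - a) + (∫ t in a..b, f t ^ 2) / c) / 2 := by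
        rw [intervalIntegral.integral_add intervalIntegrable_const (hsq.const_mul _),
          intervalIntegral.integral_const_mul, intervalIntegral.integral_const, smul_eq_mul]
        field_simp

theorem integral_abs_deriv_le_mul_sq (hu : HasL2Deriv a b u f) (hab : a < b) {σ : ℝ} (hσ : 0 < σ)
    (hf : ∫ t in a..b, f t ^ 2 ≤ σ ^ 2 * (b - a) ^ 3) :
    ∫ t in a..b, |f t| ≤ σ * (b - a) ^ 2 := by
  have hlen := sub_pos.2 hab
  have henergy : (∫ t in a..b, f t ^ 2) / (σ * (b - a)) ≤ σ * (b - a) ^ 2 := by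
    rw [div_le_iff₀ (by positivity)]
    linarith
  have := hu.integral_abs_deriv_le hab.le (c := σ * (b - a)) (by positivity)
  linarith

theorem abs_le (hu : HasL2Deriv a b u f) (ha : u a = 0) {t : ℝ} (ht : t ∈ Icc a b) :
    |u t| ≤ ∫ s in a..b, |f s| := by
  have hab : a ≤ b := ht.1.trans ht.2
  rw [hu.eq_integral t ht, ha, zero_add]
  exact (intervalIntegral.abs_integral_le_integral_abs ht.1).trans <|
    intervalIntegral.integral_mono_interval le_rfl ht.1 ht.2
      (Eventually.of_forall fun x => abs_nonneg _) (hu.intervalIntegrable_deriv hab).abs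

theorem eq_zero_of_integral_sq_eq_zero (hu : HasL2Deriv a b u f) (ha : u a = 0)
    (hf : ∫ t in a..b, f t ^ 2 = 0) {t : ℝ} (ht : t ∈ Icc a b) : u t = 0 := by
  have hab : a ≤ b := ht.1.trans ht.2
  have hsmall : ∀ c > 0, |u t| ≤ c * (b - a) / 2 := fun c hc => by
    simpa [hf] using (hu.abs_le ha ht).trans (hu.integral_abs_deriv_le hab hc)
  by_contra hne
  have hpos : 0 < |u t| := abs_pos.2 hne
  have hc := hsmall (|u t| / (b - a + 1)) (div_pos hpos (by linarith))
  have hlt : |u t| / (b - a + 1) * (b - a) ≤ |u t| := by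
    rw [div_mul_eq_mul_div, div_le_iff₀ (by linarith)]
    nlinarith
  linarith

end HasL2Deriv

end L2Deriv

section Potential

variable {g : ℝ → ℝ}

/-- The potential `G(x) = ∫₀ˣ g` of the nonlinearity. -/
noncomputable def potential (g : ℝ → ℝ) (x : ℝ) : ℝ := ∫ s in (0 : ℝ)..x, g s

theorem potential_sub (hg : Continuous g) (x y : ℝ) :
    potential g y - potential g x = ∫ s in x..y, g s :=
  intervalIntegral.integral_interval_sub_left (hg.intervalIntegrable _ _)
    (hg.intervalIntegrable _ _)

theorem hasDerivAt_potential (hg : Continuous g) (x : ℝ) : HasDerivAt (potential g) (g x) x :=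
  intervalIntegral.integral_hasDerivAt_right (hg.intervalIntegrable _ _)
    (hg.stronglyMeasurableAtFilter _ _) hg.continuousAt

theorem continuous_potential (hg : Continuous g) : Continuous (potential g) :=
  continuous_iff_continuousAt.2 fun x => (hasDerivAt_potential hg x).continuousAt

theorem abs_potential_le {C x : ℝ} (hC : ∀ s, 0 ≤ s → |g s| ≤ C) (hx : 0 ≤ x) :
    |potential g x| ≤ C * x := by
  have h := intervalIntegral.norm_integral_le_of_norm_le_const (a := 0) (b := x) (f := g) (C := C)
    fun s hs => hC s (by rw [uIoc_of_le hx] at hs; exact hs.1.le)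
  rwa [sub_zero, abs_of_nonneg hx] at h

theorem potential_add_mul_le (hg : Continuous g) {x y : ℝ} (hm : MonotoneOn g (uIcc x y)) :
    potential g x + g x * (y - x) ≤ potential g y := by
  rcases le_total x y with hxy | hxy
  · rw [uIcc_of_le hxy] at hm
    have h := intervalIntegral.integral_mono_on hxy (intervalIntegrable_const (μ := volume))
      (hg.intervalIntegrable x y) fun s hs => hm (left_mem_Icc.2 hxy) hs hs.1
    rw [intervalIntegral.integral_const, smul_eq_mul, ← potential_sub hg] at h
    linarith
  · rw [uIcc_of_ge hxy] at hm
    have h := intervalIntegral.integral_mono_on hxy (hg.intervalIntegrable y x)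
      (intervalIntegrable_const (μ := volume)) fun s hs => hm hs (right_mem_Icc.2 hxy) hs.2
    rw [intervalIntegral.integral_const, smul_eq_mul, ← potential_sub hg] at h
    linarith

end Potential

section Action

variable {g q : ℝ → ℝ} {a b : ℝ} {u f v h : ℝ → ℝ}

/-- The part `q u - G(u)` of the Lagrangian that does not involve the derivative. -/
noncomputable def lowerOrder (g q : ℝ → ℝ) (t x : ℝ) : ℝ := q t * x - potential g x

theorem lowerOrder_le_add_mul (hg : Continuous g) (hm : MonotoneOn g (Ici 0)) (t : ℝ) {x y : ℝ}
    (hx : 0 ≤ x) (hy : 0 ≤ y) :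
    lowerOrder g q t y ≤ lowerOrder g q t x + (q t - g x) * (y - x) := by
  have := potential_add_mul_le hg
    (hm.mono (uIcc_subset_Icc (a₂ := 0) (b₂ := max x y) ⟨hx, le_max_left x y⟩
      ⟨hy, le_max_right x y⟩ |>.trans Icc_subset_Ici_self))
  unfold lowerOrder
  linarith

theorem abs_lowerOrder_le {C x : ℝ} (hC : ∀ s, 0 ≤ s → |g s| ≤ C) (t : ℝ) (hx : 0 ≤ x) :
    |lowerOrder g q t x| ≤ (|q t| + C) * x := by
  have h := abs_sub (q t * x) (potential g x)
  rw [abs_mul, abs_of_nonneg hx] at h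
  have := abs_potential_le hC hx
  unfold lowerOrder
  linarith

theorem continuous_lowerOrder (hg : Continuous g) (t : ℝ) : Continuous (lowerOrder g q t) :=
  (continuous_const.mul continuous_id).sub (continuous_potential hg)

theorem intervalIntegrable_of_locallyIntegrable (hq : LocallyIntegrable q volume) (a b : ℝ) :
    IntervalIntegrable q volume a b :=
  intervalIntegrable_iff.2
    ((hq.integrableOn_isCompact isCompact_uIcc).mono_set uIoc_subset_uIcc)

theorem intervalIntegrable_lowerOrder (hg : Continuous g) (hq : LocallyIntegrable q volume)
    (hab : a ≤ b) (hu : ContinuousOn u (Icc a b)) :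
    IntervalIntegrable (fun t => lowerOrder g q t (u t)) volume a b := by
  rw [← uIcc_of_le hab] at hu
  exact ((intervalIntegrable_of_locallyIntegrable hq a b).mul_continuousOn hu).sub
    ((continuous_potential hg).comp_continuousOn hu).intervalIntegrable

namespace HasL2Deriv

theorem action_eq (hu : HasL2Deriv a b u f) (hab : a ≤ b) (hg : Continuous g)
    (hq : LocallyIntegrable q volume) :
    action g q a b u =
      (1 / 2) * (∫ t in a..b, f t ^ 2) + ∫ t in a..b, lowerOrder g q t (u t) := by
  have hsplit := hu.integral_comp_deriv_eq hab fun t y =>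
    (1 / 2) * y ^ 2 - potential g (u t) + q t * u t
  calc action g q a b u = ∫ t in a..b, ((1 / 2) * f t ^ 2 + lowerOrder g q t (u t)) := by
        refine hsplit.trans (intervalIntegral.integral_congr fun t _ => ?_)
        simp only [lowerOrder]
        ring
    _ = _ := by
        rw [intervalIntegral.integral_add ((hu.intervalIntegrable_sq hab).const_mul _)
          (intervalIntegrable_lowerOrder hg hq hab hu.continuousOn),
          intervalIntegral.integral_const_mul]

theorem action_congr (hu : HasL2Deriv a b u f) (hab : a ≤ b) (hg : Continuous g)
    (hq : LocallyIntegrable q volume) (huv : EqOn v u (Icc a b)) :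
    action g q a b v = action g q a b u := by
  rw [(hu.congr huv fun _ _ => rfl).action_eq hab hg hq, hu.action_eq hab hg hq]
  congr 1
  refine intervalIntegral.integral_congr fun t ht => ?_
  rw [uIcc_of_le hab] at ht
  simp only [huv ht]

theorem action_add_adjacent {c : ℝ} (hu : HasL2Deriv a b u f) (hg : Continuous g)
    (hq : LocallyIntegrable q volume) (hac : a ≤ c) (hcb : c ≤ b) :
    action g q a c u + action g q c b u = action g q a b u := by
  have hl := hu.mono le_rfl hcb
  have hr := hu.mono hac le_rfl
  rw [hl.action_eq hac hg hq, hr.action_eq hcb hg hq, hu.action_eq (hac.trans hcb) hg hq,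
    ← intervalIntegral.integral_add_adjacent_intervals (hl.intervalIntegrable_sq hac)
      (hr.intervalIntegrable_sq hcb),
    ← intervalIntegral.integral_add_adjacent_intervals
      (intervalIntegrable_lowerOrder hg hq hac hl.continuousOn)
      (intervalIntegrable_lowerOrder hg hq hcb hr.continuousOn)]
  ring

end HasL2Deriv

theorem action_congr_force {r : ℝ → ℝ} (hab : a ≤ b) (h : EqOn q r (Icc a b)) (u : ℝ → ℝ) :
    action g q a b u = action g r a b u := by
  refine intervalIntegral.integral_congr fun t ht => ?_
  rw [uIcc_of_le hab] at ht
  simp only [h ht]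

end Action

section SecondDeriv

variable {a b : ℝ} {u u' u'' v v' v'' : ℝ → ℝ} {s : Set ℝ}

/-- `u` is twice differentiable at the points of `s`, with derivatives `u'` and `u''`. Derivatives
are two-sided: on a compact interval `u` has to be differentiable across the endpoints. -/
structure HasSecondDerivOn (u u' u'' : ℝ → ℝ) (s : Set ℝ) : Prop where
  fst : ∀ t ∈ s, HasDerivAt u (u' t) t
  snd : ∀ t ∈ s, HasDerivAt u' (u'' t) t

namespace HasSecondDerivOn

theorem mono (hu : HasSecondDerivOn u u' u'' s) {r : Set ℝ} (hr : r ⊆ s) :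
    HasSecondDerivOn u u' u'' r :=
  ⟨fun t ht => hu.fst t (hr ht), fun t ht => hu.snd t (hr ht)⟩

theorem sub (hu : HasSecondDerivOn u u' u'' s) (hv : HasSecondDerivOn v v' v'' s) :
    HasSecondDerivOn (fun t => u t - v t) (fun t => u' t - v' t) (fun t => u'' t - v'' t) s :=
  ⟨fun t ht => (hu.fst t ht).sub (hv.fst t ht), fun t ht => (hu.snd t ht).sub (hv.snd t ht)⟩

theorem neg (hu : HasSecondDerivOn u u' u'' s) :
    HasSecondDerivOn (fun t => -u t) (fun t => -u' t) (fun t => -u'' t) s :=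
  ⟨fun t ht => (hu.fst t ht).neg, fun t ht => (hu.snd t ht).neg⟩

theorem continuousOn (hu : HasSecondDerivOn u u' u'' s) : ContinuousOn u s :=
  fun t ht => (hu.fst t ht).continuousAt.continuousWithinAt

theorem continuousOn_fst (hu : HasSecondDerivOn u u' u'' s) : ContinuousOn u' s :=
  fun t ht => (hu.snd t ht).continuousAt.continuousWithinAt

theorem hasL2Deriv (hu : HasSecondDerivOn u u' u'' (Icc a b)) : HasL2Deriv a b u u' :=
  .of_hasDerivAt hu.continuousOn hu.continuousOn_fst fun t ht =>
    hu.fst t (Ioo_subset_Icc_self ht)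

end HasSecondDerivOn

theorem exists_hasSecondDerivOn {F : ℝ → ℝ} (hab : a ≤ b) (hF : ContinuousOn F (Icc a b))
    (y₀ y₁ : ℝ) :
    ∃ U U' : ℝ → ℝ, HasSecondDerivOn U U' F (Icc a b) ∧ U a = y₀ ∧ U' a = y₁ := by
  set F₁ : ℝ → ℝ := IccExtend hab ((Icc a b).domRestrict F)
  have hF₁c : Continuous F₁ := continuous_IccExtend_iff.2 hF.domRestrict
  have hprim : ∀ {k : ℝ → ℝ} (y : ℝ), Continuous k → ∀ t,
      HasDerivAt (fun t => y + ∫ x in a..t, k x) (k t) t := fun y hk t =>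
    (intervalIntegral.integral_hasDerivAt_right (hk.intervalIntegrable _ _)
      (hk.stronglyMeasurableAtFilter _ _) hk.continuousAt).const_add y
  have hU'c : Continuous fun t => y₁ + ∫ x in a..t, F₁ x :=
    continuous_iff_continuousAt.2 fun t => (hprim y₁ hF₁c t).continuousAt
  refine ⟨_, _, ⟨fun t _ => hprim y₀ hU'c t, fun t ht => ?_⟩, by simp, by simp⟩
  have hval : F₁ t = F t := IccExtend_of_mem hab _ ht
  exact hval ▸ hprim y₁ hF₁c t

end SecondDeriv

section DuBoisReymond

variable {s e : ℝ} {Φ k : ℝ → ℝ}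

theorem eq_affine_of_forall_integral_mul_deriv_eq_zero (hΦ : HasL2Deriv s e Φ k)
    (h0 : ∀ φ h : ℝ → ℝ, HasL2Deriv s e φ h → φ s = 0 → φ e = 0 → ∫ t in s..e, k t * h t = 0)
    {t : ℝ} (ht : t ∈ Icc s e) : Φ t * (e - s) = Φ s * (e - t) + Φ e * (t - s) := by
  have hse : s ≤ e := ht.1.trans ht.2
  rcases hse.eq_or_lt with rfl | hlt
  · obtain rfl : t = s := le_antisymm ht.2 ht.1
    ring
  have hes : e - s ≠ 0 := (sub_pos.2 hlt).ne'
  set c := (Φ e - Φ s) / (e - s) with hc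
  have haff : HasL2Deriv s e (fun t => Φ s + c * (t - s)) fun _ => c :=
    .of_hasDerivAt (by fun_prop) (by fun_prop) fun t _ => by
      simpa using (((hasDerivAt_id t).sub_const s).const_mul c).const_add (Φ s)
  have hφ := hΦ.sub haff
  have hφs : Φ s - (Φ s + c * (s - s)) = 0 := by ring
  have hφe : Φ e - (Φ s + c * (e - s)) = 0 := by rw [hc]; field_simp; ring
  have hsq : ∫ t in s..e, (k t - c) ^ 2 = 0 := by
    have hi := hφ.intervalIntegrable_deriv hse
    calc ∫ t in s..e, (k t - c) ^ 2 = ∫ t in s..e, (k t * (k t - c) - c * (k t - c)) :=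
          intervalIntegral.integral_congr fun t _ => by ring
      _ = (∫ t in s..e, k t * (k t - c)) - c * ∫ t in s..e, (k t - c) := by
          rw [intervalIntegral.integral_sub (hΦ.intervalIntegrable_mul hφ hse) (hi.const_mul c),
            intervalIntegral.integral_const_mul]
      _ = 0 := by
          rw [h0 _ _ hφ hφs hφe,
            ← hφ.sub_eq_integral (left_mem_Icc.2 hse) (right_mem_Icc.2 hse), hφs, hφe]
          ring
  have hzero := hφ.eq_zero_of_integral_sq_eq_zero hφs hsq ht
  rw [sub_eq_zero.1 hzero, hc]
  field_simp
  ring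

theorem eq_affine_of_forall_Ioo {a b : ℝ} (hΦ : ContinuousOn Φ (Icc a b))
    (h : ∀ s t e, a < s → s ≤ t → t ≤ e → e < b →
      Φ t * (e - s) = Φ s * (e - t) + Φ e * (t - s))
    {t : ℝ} (ht : t ∈ Icc a b) : Φ t * (b - a) = Φ a * (b - t) + Φ b * (t - a) := by
  rcases ht.1.eq_or_lt with rfl | hat
  · ring
  rcases ht.2.eq_or_lt with rfl | htb
  · ring
  have hab := hat.trans htb
  have hΦa : Tendsto Φ (𝓝[>] a) (𝓝 (Φ a)) := by
    rw [← nhdsWithin_Ioo_eq_nhdsGT hab]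
    exact (hΦ a (left_mem_Icc.2 hab.le)).mono Ioo_subset_Icc_self
  have hΦb : Tendsto Φ (𝓝[<] b) (𝓝 (Φ b)) := by
    rw [← nhdsWithin_Ioo_eq_nhdsLT hab]
    exact (hΦ b (right_mem_Icc.2 hab.le)).mono Ioo_subset_Icc_self
  have hs : Tendsto (fun x : ℝ × ℝ => x.1) (𝓝[>] a ×ˢ 𝓝[<] b) (𝓝 a) :=
    tendsto_fst.mono_right nhdsWithin_le_nhds
  have he : Tendsto (fun x : ℝ × ℝ => x.2) (𝓝[>] a ×ˢ 𝓝[<] b) (𝓝 b) :=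
    tendsto_snd.mono_right nhdsWithin_le_nhds
  refine tendsto_nhds_unique_of_eventuallyEq ((he.sub hs).const_mul (Φ t))
    (((hΦa.comp tendsto_fst).mul (he.sub_const t)).add
      ((hΦb.comp tendsto_snd).mul (hs.const_sub t))) ?_
  filter_upwards [prod_mem_prod (Ioo_mem_nhdsGT hat) (Ioo_mem_nhdsLT htb)] with x hx
  exact h x.1 t x.2 hx.1.1 hx.1.2.le hx.2.1.le hx.2.2

end DuBoisReymond

section Variation

variable {g q : ℝ → ℝ} {a b α β : ℝ} {u f v h : ℝ → ℝ}

theorem piecewise_Icc_eqOn_Iic (hαβ : α ≤ β) (hvα : v α = u α) :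
    EqOn ((Icc α β).piecewise v u) u (Iic α) := fun t ht => by
  rcases (mem_Iic.1 ht).eq_or_lt with rfl | hlt
  · exact (piecewise_eq_of_mem _ _ _ (left_mem_Icc.2 hαβ)).trans hvα
  · exact piecewise_eq_of_notMem _ _ _ fun h => h.1.not_gt hlt

theorem piecewise_Icc_eqOn_Ici (hαβ : α ≤ β) (hvβ : v β = u β) :
    EqOn ((Icc α β).piecewise v u) u (Ici β) := fun t ht => by
  rcases (mem_Ici.1 ht).eq_or_lt with rfl | hlt
  · exact (piecewise_eq_of_mem _ _ _ (right_mem_Icc.2 hαβ)).trans hvβ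
  · exact piecewise_eq_of_notMem _ _ _ fun h => h.2.not_gt hlt

theorem HasL2Deriv.piecewise (hu : HasL2Deriv a b u f) (hα : a ≤ α) (hαβ : α ≤ β) (hβ : β ≤ b)
    (hv : HasL2Deriv α β v h) (hvα : v α = u α) (hvβ : v β = u β) :
    HasL2Deriv a b ((Icc α β).piecewise v u) ((Ioo α β).piecewise h f) := by
  have hl : HasL2Deriv a α ((Icc α β).piecewise v u) ((Ioo α β).piecewise h f) :=
    (hu.mono le_rfl (hαβ.trans hβ)).congr
      ((piecewise_Icc_eqOn_Iic hαβ hvα).mono Icc_subset_Iic_self)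
      fun t ht => piecewise_eq_of_notMem _ _ _ fun h => h.1.not_gt ht.2
  have hr : HasL2Deriv β b ((Icc α β).piecewise v u) ((Ioo α β).piecewise h f) :=
    (hu.mono (hα.trans hαβ) le_rfl).congr
      ((piecewise_Icc_eqOn_Ici hαβ hvβ).mono Icc_subset_Ici_self)
      fun t ht => piecewise_eq_of_notMem _ _ _ fun h => h.2.not_gt ht.1
  exact (hl.concat hα hαβ (hv.congr (piecewise_eqOn _ _ _) (piecewise_eqOn _ _ _))).concat
    (hα.trans hαβ) hβ hr

namespace IsNonnegMinimizer

theorem hasL2Deriv (hu : IsNonnegMinimizer g q a b u) (hab : a ≤ b) :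
    HasL2Deriv a b u (deriv u) := .of_memH1 hu.1.1.1 hab

theorem congr_force {r : ℝ → ℝ} (hu : IsNonnegMinimizer g q a b u) (hab : a ≤ b)
    (h : EqOn q r (Icc a b)) : IsNonnegMinimizer g r a b u :=
  ⟨hu.1, fun v hv => by
    rw [← action_congr_force hab h, ← action_congr_force hab h]; exact hu.2 v hv⟩

theorem action_le_action (hu : IsNonnegMinimizer g q a b u) (hg : Continuous g)
    (hq : LocallyIntegrable q volume) (hα : a ≤ α) (hαβ : α ≤ β) (hβ : β ≤ b)
    (hv : HasL2Deriv α β v f) (hvα : v α = u α) (hvβ : v β = u β)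
    (hv0 : ∀ t ∈ Icc α β, 0 ≤ v t) : action g q α β u ≤ action g q α β v := by
  have hab : a ≤ b := hα.trans (hαβ.trans hβ)
  have hU := hu.hasL2Deriv hab
  set w := (Icc α β).piecewise v u
  have hw := hU.piecewise hα hαβ hβ hv hvα hvβ
  have hwl : EqOn w u (Icc a α) := (piecewise_Icc_eqOn_Iic hαβ hvα).mono Icc_subset_Iic_self
  have hwr : EqOn w u (Icc β b) := (piecewise_Icc_eqOn_Ici hαβ hvβ).mono Icc_subset_Ici_self
  have hmem : w ∈ H10plus a b := by
    refine ⟨⟨hw.memH1 hab, ?_, ?_⟩, fun t ht => ?_⟩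
    · rw [hwl (left_mem_Icc.2 hα)]; exact hu.1.1.2.1
    · rw [hwr (right_mem_Icc.2 hβ)]; exact hu.1.1.2.2
    · by_cases htαβ : t ∈ Icc α β
      · rw [show w t = v t from piecewise_eq_of_mem _ _ _ htαβ]; exact hv0 t htαβ
      · rw [show w t = u t from piecewise_eq_of_notMem _ _ _ htαβ]; exact hu.1.2 t ht
  have hle := hu.2 w hmem
  have hUβ := hU.mono (α := a) le_rfl hβ
  have hwβ := hw.mono (α := a) le_rfl hβ
  rw [← hU.action_add_adjacent hg hq (hα.trans hαβ) hβ, ← hUβ.action_add_adjacent hg hq hα hαβ,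
    ← hw.action_add_adjacent hg hq (hα.trans hαβ) hβ, ← hwβ.action_add_adjacent hg hq hα hαβ,
    (hU.mono le_rfl (hαβ.trans hβ)).action_congr hα hg hq hwl,
    (hU.mono (hα.trans hαβ) le_rfl).action_congr hβ hg hq hwr,
    hv.action_congr hαβ hg hq (piecewise_eqOn _ _ _)] at hle
  linarith

end IsNonnegMinimizer

/-- The first variation of the action on `[s,e]` at `u`, in a direction `φ` with derivative `h`. -/
noncomputable def firstVariation (g q u : ℝ → ℝ) (s e : ℝ) (φ h : ℝ → ℝ) : ℝ :=
  (∫ t in s..e, deriv u t * h t) + ∫ t in s..e, (q t - g (u t)) * φ t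

theorem firstVariation_const_mul (g q u : ℝ → ℝ) (s e c : ℝ) (φ h : ℝ → ℝ) :
    firstVariation g q u s e (fun t => c * φ t) (fun t => c * h t) =
      c * firstVariation g q u s e φ h := by
  unfold firstVariation
  rw [mul_add, ← intervalIntegral.integral_const_mul, ← intervalIntegral.integral_const_mul]
  congr 1 <;> exact intervalIntegral.integral_congr fun t _ => by ring

theorem intervalIntegrable_force_mul (hg : Continuous g) (hq : LocallyIntegrable q volume)
    (hab : a ≤ b) (hu : ContinuousOn u (Icc a b)) (hv : ContinuousOn v (Icc a b)) :
    IntervalIntegrable (fun t => (q t - g (u t)) * v t) volume a b := by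
  rw [← uIcc_of_le hab] at hu hv
  exact ((intervalIntegrable_of_locallyIntegrable hq a b).sub
    (hg.comp_continuousOn hu).intervalIntegrable).mul_continuousOn hv

theorem HasL2Deriv.action_add_le (hu : HasL2Deriv a b u (deriv u)) (hab : a ≤ b)
    (hg : Continuous g) (hm : MonotoneOn g (Ici 0)) (hq : LocallyIntegrable q volume)
    (hv : HasL2Deriv a b v h) (hu0 : ∀ t ∈ Icc a b, 0 ≤ u t)
    (huv0 : ∀ t ∈ Icc a b, 0 ≤ u t + v t) :
    action g q a b (fun t => u t + v t) ≤
      action g q a b u + firstVariation g q u a b v h + (1 / 2) * ∫ t in a..b, h t ^ 2 := by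
  have hsq := hu.intervalIntegrable_sq hab
  have hmul := hu.intervalIntegrable_mul hv hab
  have hlow := intervalIntegrable_lowerOrder hg hq hab hu.continuousOn
  have hforce := intervalIntegrable_force_mul hg hq hab hu.continuousOn hv.continuousOn
  have hlower : ∫ t in a..b, lowerOrder g q t (u t + v t) ≤
      (∫ t in a..b, lowerOrder g q t (u t)) + ∫ t in a..b, (q t - g (u t)) * v t := by
    rw [← intervalIntegral.integral_add hlow hforce]
    refine intervalIntegral.integral_mono_on hab
      (intervalIntegrable_lowerOrder hg hq hab (hu.add hv).continuousOn)
      (hlow.add hforce) fun t ht => ?_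
    simpa using lowerOrder_le_add_mul (q := q) hg hm t (hu0 t ht) (huv0 t ht)
  have hkin : ∫ t in a..b, (deriv u t + h t) ^ 2 = (∫ t in a..b, deriv u t ^ 2) +
      2 * (∫ t in a..b, deriv u t * h t) + ∫ t in a..b, h t ^ 2 := by
    rw [← intervalIntegral.integral_const_mul, ← intervalIntegral.integral_add hsq
      (hmul.const_mul 2), ← intervalIntegral.integral_add (hsq.add (hmul.const_mul 2))
      (hv.intervalIntegrable_sq hab)]
    exact intervalIntegral.integral_congr fun t _ => by ring
  rw [(hu.add hv).action_eq hab hg hq, hu.action_eq hab hg hq, hkin]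
  unfold firstVariation
  linarith

theorem nonneg_of_eventually_nonneg_mul_add_sq {x c : ℝ}
    (h : ∀ᶠ τ in 𝓝[>] (0 : ℝ), 0 ≤ τ * x + τ ^ 2 * c) : 0 ≤ x := by
  have hlim : Tendsto (fun τ : ℝ => x + τ * c) (𝓝[>] 0) (𝓝 x) :=
    (Continuous.tendsto' (by fun_prop) 0 x (by simp)).mono_left nhdsWithin_le_nhds
  refine ge_of_tendsto hlim ?_
  filter_upwards [h, self_mem_nhdsWithin] with τ hτ hpos
  exact nonneg_of_mul_nonneg_right (by linarith : 0 ≤ τ * (x + τ * c)) hpos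

namespace IsNonnegMinimizer

theorem firstVariation_nonneg_of_eventually (hu : IsNonnegMinimizer g q a b u)
    (hg : Continuous g) (hm : MonotoneOn g (Ici 0)) (hq : LocallyIntegrable q volume)
    (hα : a ≤ α) (hαβ : α ≤ β) (hβ : β ≤ b) (hv : HasL2Deriv α β v h) (hvα : v α = 0)
    (hvβ : v β = 0) (hpos : ∀ᶠ τ in 𝓝[>] (0 : ℝ), ∀ t ∈ Icc α β, 0 ≤ u t + τ * v t) :
    0 ≤ firstVariation g q u α β v h := by
  have hab : a ≤ b := hα.trans (hαβ.trans hβ)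
  have hU := (hu.hasL2Deriv hab).mono hα hβ
  refine nonneg_of_eventually_nonneg_mul_add_sq (c := (1 / 2) * ∫ t in α..β, h t ^ 2) ?_
  filter_upwards [hpos] with τ hτ
  have hle := hu.action_le_action hg hq hα hαβ hβ (hU.add (hv.const_mul τ)) (by simp [hvα])
    (by simp [hvβ]) hτ
  have hexp := hU.action_add_le hαβ hg hm hq (hv.const_mul τ)
    (fun t ht => hu.1.2 t ⟨hα.trans ht.1, ht.2.trans hβ⟩) hτ
  simp only [mul_pow, intervalIntegral.integral_const_mul, firstVariation_const_mul] at hexp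
  linarith

theorem firstVariation_nonneg (hu : IsNonnegMinimizer g q a b u) (hg : Continuous g)
    (hm : MonotoneOn g (Ici 0)) (hq : LocallyIntegrable q volume)
    (hα : a ≤ α) (hαβ : α ≤ β) (hβ : β ≤ b) (hv : HasL2Deriv α β v h) (hvα : v α = 0)
    (hvβ : v β = 0) (hv0 : ∀ t ∈ Icc α β, 0 ≤ v t) : 0 ≤ firstVariation g q u α β v h := by
  refine hu.firstVariation_nonneg_of_eventually hg hm hq hα hαβ hβ hv hvα hvβ ?_
  filter_upwards [self_mem_nhdsWithin] with τ hτ t ht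
  exact add_nonneg (hu.1.2 t ⟨hα.trans ht.1, ht.2.trans hβ⟩)
    (mul_nonneg (mem_Ioi.1 hτ).le (hv0 t ht))

theorem firstVariation_eq_zero (hu : IsNonnegMinimizer g q a b u) (hg : Continuous g)
    (hm : MonotoneOn g (Ici 0)) (hq : LocallyIntegrable q volume)
    (hpos : ∀ t ∈ Ioo a b, 0 < u t) (hα : a < α) (hαβ : α ≤ β) (hβ : β < b)
    (hv : HasL2Deriv α β v h) (hvα : v α = 0) (hvβ : v β = 0) :
    firstVariation g q u α β v h = 0 := by
  have hab : a ≤ b := hα.le.trans (hαβ.trans hβ.le)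
  have hU := (hu.hasL2Deriv hab).mono hα.le hβ.le
  obtain ⟨t₀, ht₀, hmin⟩ := isCompact_Icc.exists_isMinOn (nonempty_Icc.2 hαβ) hU.continuousOn
  have hut₀ : 0 < u t₀ := hpos t₀ ⟨hα.trans_le ht₀.1, ht₀.2.trans_lt hβ⟩
  have hsmall : ∀ w k : ℝ → ℝ, HasL2Deriv α β w k → w α = 0 → w β = 0 →
      0 ≤ firstVariation g q u α β w k := fun w k hw hwα hwβ => by
    obtain ⟨B, hB⟩ := isCompact_Icc.exists_bound_of_continuousOn hw.continuousOn
    have hlim : Tendsto (fun τ : ℝ => τ * B) (𝓝[>] 0) (𝓝 0) :=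
      (Continuous.tendsto' (by fun_prop) 0 0 (by simp)).mono_left nhdsWithin_le_nhds
    refine hu.firstVariation_nonneg_of_eventually hg hm hq hα.le hαβ hβ.le hw hwα hwβ ?_
    filter_upwards [hlim.eventually_lt_const hut₀, self_mem_nhdsWithin] with τ hτ hτ0 t ht
    have hle : u t₀ ≤ u t := hmin ht
    have hτB := mul_le_mul_of_nonneg_left ((neg_le_abs (w t)).trans (hB t ht)) (mem_Ioi.1 hτ0).le
    linarith
  have hneg := hsmall _ _ (hv.const_mul (-1)) (by simp [hvα]) (by simp [hvβ])
  rw [firstVariation_const_mul] at hneg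
  linarith [hsmall v h hv hvα hvβ]

end IsNonnegMinimizer

end Variation

section EulerLagrange

variable {g q : ℝ → ℝ} {a b : ℝ} {u : ℝ → ℝ}

namespace IsNonnegMinimizer

theorem exists_affine_add (hu : IsNonnegMinimizer g q a b u) (hg : Continuous g)
    (hm : MonotoneOn g (Ici 0)) (hq : Continuous q) (hab : a < b) (hpos : ∀ t ∈ Ioo a b, 0 < u t)
    {U U' : ℝ → ℝ} (hU : HasSecondDerivOn U U' (fun t => q t - g (u t)) (Icc a b)) :
    ∃ y c : ℝ, ∀ t ∈ Icc a b, u t = U t + (y + c * (t - a)) := by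
  have hu₁ := hu.hasL2Deriv hab.le
  have hF : ContinuousOn (fun t => q t - g (u t)) (Icc a b) :=
    hq.continuousOn.sub (hg.comp_continuousOn hu₁.continuousOn)
  have hU₁ := hU.hasL2Deriv
  have hU₂ : HasL2Deriv a b U' (fun t => q t - g (u t)) :=
    .of_hasDerivAt hU.continuousOn_fst hF fun t ht => hU.snd t (Ioo_subset_Icc_self ht)
  have haff := fun t (ht : t ∈ Icc a b) => eq_affine_of_forall_Ioo
    (Φ := fun t => u t - U t) (hu₁.continuousOn.sub hU.continuousOn) (fun s t e hs hst hte he => by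
      have hse := hst.trans hte
      refine eq_affine_of_forall_integral_mul_deriv_eq_zero
        ((hu₁.mono hs.le he.le).sub (hU₁.mono hs.le he.le)) (fun φ h hφ hφs hφe => ?_) ⟨hst, hte⟩
      have hparts := (hU₂.mono hs.le he.le).integral_mul_deriv_eq hφ hse
      have hvar := hu.firstVariation_eq_zero hg hm hq.locallyIntegrable hpos hs hse he hφ hφs hφe
      simp only [hφs, hφe, mul_zero, sub_zero, zero_sub] at hparts
      simp only [firstVariation] at hvar
      simp only [sub_mul]
      rw [intervalIntegral.integral_sub ((hu₁.mono hs.le he.le).intervalIntegrable_mul hφ hse)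
        ((hU₁.mono hs.le he.le).intervalIntegrable_mul hφ hse), hparts]
      simp only [sub_neg_eq_add]
      exact hvar) ht
  refine ⟨u a - U a, ((u b - U b) - (u a - U a)) / (b - a), fun t ht => ?_⟩
  have hba : b - a ≠ 0 := (sub_pos.2 hab).ne'
  have ht' := haff t ht
  field_simp
  linarith

theorem exists_hasSecondDerivOn (hu : IsNonnegMinimizer g q a b u) (hg : Continuous g)
    (hm : MonotoneOn g (Ici 0)) (hq : Continuous q) (hab : a < b)
    (hpos : ∀ t ∈ Ioo a b, 0 < u t) :
    ∃ U U' : ℝ → ℝ, EqOn U u (Icc a b) ∧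
      HasSecondDerivOn U U' (fun t => q t - g (u t)) (Icc a b) := by
  have hF : ContinuousOn (fun t => q t - g (u t)) (Icc a b) :=
    hq.continuousOn.sub (hg.comp_continuousOn (hu.hasL2Deriv hab.le).continuousOn)
  obtain ⟨U, U', hU, -⟩ := DualNehari.exists_hasSecondDerivOn hab.le hF 0 0
  obtain ⟨y, c, hyc⟩ := hu.exists_affine_add hg hm hq hab hpos hU
  refine ⟨fun t => U t + (y + c * (t - a)), fun t => U' t + c, fun t ht => (hyc t ht).symm,
    fun t ht => ?_, fun t ht => (hU.snd t ht).add_const c⟩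
  have haff : HasDerivAt (fun t => y + c * (t - a)) c t := by
    simpa using (((hasDerivAt_id t).sub_const a).const_mul c).const_add y
  exact (hU.fst t ht).add haff

end IsNonnegMinimizer

end EulerLagrange

section Existence

theorem exists_subseq_tendsto_inner {X : Type*} [NormedAddCommGroup X] [InnerProductSpace ℝ X]
    [CompleteSpace X] [TopologicalSpace.SeparableSpace X] {F : ℕ → X} {R : ℝ}
    (hF : ∀ n, ‖F n‖ ≤ R) :
    ∃ (L : X) (φ : ℕ → ℕ), StrictMono φ ∧
      ∀ y, Tendsto (fun n => inner ℝ (F (φ n)) y) atTop (𝓝 (inner ℝ L y)) := by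
  obtain ⟨x, -, φ, hφ, hx⟩ := WeakDual.isSeqCompact_closedBall ℝ X (0 : StrongDual ℝ X) R
    (x := fun n => StrongDual.toWeakDual (InnerProductSpace.toDual ℝ X (F n)))
    (fun n => by simpa using hF n)
  refine ⟨(InnerProductSpace.toDual ℝ X).symm (WeakDual.toStrongDual x), φ, hφ, fun y => ?_⟩
  rw [InnerProductSpace.toDual_symm_apply]
  exact ((WeakDual.eval_continuous (𝕜 := ℝ) y).tendsto x).comp hx

theorem inner_toLp_eq_integral_mul {X : Type*} [MeasurableSpace X] {μ : Measure X} {f h : X → ℝ}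
    (hf : MemLp f 2 μ) (hh : MemLp h 2 μ) :
    inner ℝ (hf.toLp f) (hh.toLp h) = ∫ x, f x * h x ∂μ := by
  rw [L2.inner_def]
  refine integral_congr_ae ?_
  filter_upwards [hf.coeFn_toLp, hh.coeFn_toLp] with x hx hx'
  rw [hx, hx', real_inner_eq_re_inner, RCLike.inner_apply, conj_trivial, mul_comm]
  rfl

theorem exists_subseq_tendsto_integral_mul {X : Type*} [MeasurableSpace X] {μ : Measure X}
    [IsSeparable μ] {f : ℕ → X → ℝ} {D : ℝ} (hf : ∀ n, MemLp (f n) 2 μ)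
    (hD : ∀ n, ∫ x, f n x ^ 2 ∂μ ≤ D) :
    ∃ (F : X → ℝ) (φ : ℕ → ℕ), StrictMono φ ∧ MemLp F 2 μ ∧ ∀ h, MemLp h 2 μ →
      Tendsto (fun n => ∫ x, f (φ n) x * h x ∂μ) atTop (𝓝 (∫ x, F x * h x ∂μ)) := by
  have : Fact ((2 : ℝ≥0∞) ≠ ∞) := ⟨by norm_num⟩
  obtain ⟨L, φ, hφ, hL⟩ := exists_subseq_tendsto_inner (F := fun n => (hf n).toLp) (R := √D)
    fun n => Real.le_sqrt_of_sq_le <| by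
      rw [← real_inner_self_eq_norm_sq, inner_toLp_eq_integral_mul]
      simpa only [sq] using hD n
  refine ⟨L, φ, hφ, Lp.memLp L, fun h hh => ?_⟩
  have hlim := hL hh.toLp
  simp only [inner_toLp_eq_integral_mul] at hlim
  rwa [← inner_toLp_eq_integral_mul (Lp.memLp L) hh, Lp.toLp_coeFn]

variable {g q u f : ℝ → ℝ} {a b C D : ℝ}

theorem HasL2Deriv.exists_subseq_tendsto {v k : ℕ → ℝ → ℝ} (hab : a ≤ b)
    (hv : ∀ n, HasL2Deriv a b (v n) (k n)) (h0 : ∀ n, v n a = 0)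
    (hD : ∀ n, ∫ t in a..b, k n t ^ 2 ≤ D) :
    ∃ (u f : ℝ → ℝ) (φ : ℕ → ℕ), StrictMono φ ∧ HasL2Deriv a b u f ∧
      (∀ t ∈ Icc a b, Tendsto (fun n => v (φ n) t) atTop (𝓝 (u t))) ∧
      Tendsto (fun n => ∫ t in a..b, k (φ n) t * f t) atTop (𝓝 (∫ t in a..b, f t ^ 2)) := by
  simp only [intervalIntegral.integral_of_le hab, integral_Ioc_eq_integral_Ioo] at hD ⊢
  obtain ⟨f, φ, hφ, hf, hlim⟩ := exists_subseq_tendsto_integral_mul (fun n => (hv n).memLp) hD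
  have hu : HasL2Deriv a b (fun t => ∫ s in a..t, f s) f := ⟨hf, fun t _ => by simp⟩
  refine ⟨_, f, φ, hφ, hu, fun t ht => ?_, by simpa only [sq] using hlim f hf⟩
  have hset : ∀ k : ℝ → ℝ, ∫ s in Ioo a b, k s * (Ioo a t).indicator 1 s = ∫ s in a..t, k s :=
    fun k => by
      rw [intervalIntegral.integral_of_le ht.1, integral_Ioc_eq_integral_Ioo,
        ← inter_eq_right.2 (Ioo_subset_Ioo_right ht.2), ← setIntegral_indicator measurableSet_Ioo]
      simp only [indicator_apply, Pi.one_apply, mul_ite, mul_one, mul_zero,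
        inter_eq_right.2 (Ioo_subset_Ioo_right ht.2)]
  have hind := hlim ((Ioo a t).indicator 1)
    (memLp_indicator_const 2 measurableSet_Ioo (1 : ℝ) (Or.inr (measure_ne_top _ _)))
  simp only [hset] at hind
  refine hind.congr fun n => ?_
  rw [(hv (φ n)).eq_integral t ht, h0, zero_add]

theorem HasL2Deriv.abs_integral_lowerOrder_le (hu : HasL2Deriv a b u f) (hab : a ≤ b)
    (hC : ∀ s, 0 ≤ s → |g s| ≤ C) (hq : LocallyIntegrable q volume) (ha : u a = 0)
    (hu0 : ∀ t ∈ Icc a b, 0 ≤ u t) :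
    |∫ t in a..b, lowerOrder g q t (u t)| ≤
      (∫ t in a..b, (|q t| + C)) * ∫ t in a..b, |f t| := by
  rw [← intervalIntegral.integral_mul_const, ← Real.norm_eq_abs]
  refine intervalIntegral.norm_integral_le_of_norm_le hab (ae_of_all _ fun t ht => ?_)
    (((intervalIntegrable_of_locallyIntegrable hq a b).abs.add
      intervalIntegrable_const).mul_const _)
  have ht' := Ioc_subset_Icc_self ht
  refine (abs_lowerOrder_le hC t (hu0 t ht')).trans ?_
  have hC0 : 0 ≤ C := (abs_nonneg _).trans (hC 0 le_rfl)
  gcongr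
  exact (le_abs_self _).trans (hu.abs_le ha ht')

theorem HasL2Deriv.integral_sq_le_of_action (hu : HasL2Deriv a b u f) (hab : a ≤ b)
    (hg : Continuous g) (hC : ∀ s, 0 ≤ s → |g s| ≤ C) (hq : LocallyIntegrable q volume)
    (ha : u a = 0) (hu0 : ∀ t ∈ Icc a b, 0 ≤ u t) :
    ∫ t in a..b, f t ^ 2 ≤
      4 * (action g q a b u + ((∫ t in a..b, (|q t| + C)) + 1) ^ 2 * (b - a)) := by
  have hlow := hu.abs_integral_lowerOrder_le hab hC hq ha hu0
  set S := ∫ t in a..b, |f t|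
  set M := ∫ t in a..b, (|q t| + C)
  have hC0 : 0 ≤ C := (abs_nonneg _).trans (hC 0 le_rfl)
  have hM : 0 ≤ M := intervalIntegral.integral_nonneg hab fun t _ => by positivity
  have hS : 0 ≤ S := intervalIntegral.integral_nonneg hab fun t _ => abs_nonneg _
  have hS' := mul_le_mul_of_nonneg_left
    (hu.integral_abs_deriv_le hab (c := 2 * (M + 1)) (by positivity)) (by positivity : 0 ≤ M + 1)
  rw [hu.action_eq hab hg hq]
  set E := ∫ t in a..b, f t ^ 2
  have hyoung : (M + 1) * ((2 * (M + 1) * (b - a) + E / (2 * (M + 1))) / 2) =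
      (M + 1) ^ 2 * (b - a) + E / 4 := by
    field_simp
    ring
  linarith [neg_abs_le (∫ t in a..b, lowerOrder g q t (u t))]

theorem HasL2Deriv.tendsto_integral_lowerOrder {v k : ℕ → ℝ → ℝ} (hab : a ≤ b)
    (hg : Continuous g) (hC : ∀ s, 0 ≤ s → |g s| ≤ C) (hq : LocallyIntegrable q volume)
    (hv : ∀ n, HasL2Deriv a b (v n) (k n)) (ha : ∀ n, v n a = 0)
    (hv0 : ∀ n, ∀ t ∈ Icc a b, 0 ≤ v n t) (hD : ∀ n, ∫ t in a..b, k n t ^ 2 ≤ D)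
    (hlim : ∀ t ∈ Icc a b, Tendsto (fun n => v n t) atTop (𝓝 (u t))) :
    Tendsto (fun n => ∫ t in a..b, lowerOrder g q t (v n t)) atTop
      (𝓝 (∫ t in a..b, lowerOrder g q t (u t))) := by
  have hsub : uIoc a b ⊆ Icc a b := by rw [uIoc_of_le hab]; exact Ioc_subset_Icc_self
  have hC0 : 0 ≤ C := (abs_nonneg _).trans (hC 0 le_rfl)
  have hB : ∀ n, ∀ t ∈ Icc a b, v n t ≤ ((b - a) + D) / 2 := fun n t ht => by
    have hS := (hv n).integral_abs_deriv_le hab one_pos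
    simp only [one_mul, div_one] at hS
    linarith [le_abs_self (v n t), (hv n).abs_le (ha n) ht, hD n]
  refine intervalIntegral.tendsto_integral_filter_of_dominated_convergence
    (fun t => (|q t| + C) * (((b - a) + D) / 2))
    (Eventually.of_forall fun n => ?_)
    (Eventually.of_forall fun n => ae_of_all _ fun t ht =>
      (abs_lowerOrder_le hC t (hv0 n t (hsub ht))).trans
        (mul_le_mul_of_nonneg_left (hB n t (hsub ht)) (by positivity)))
    (((intervalIntegrable_of_locallyIntegrable hq a b).abs.add
      intervalIntegrable_const).mul_const _)
    (ae_of_all _ fun t ht => ((continuous_lowerOrder hg t).tendsto _).comp (hlim t (hsub ht)))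
  rw [uIoc_of_le hab]
  exact (intervalIntegrable_lowerOrder hg hq hab (hv n).continuousOn).1.aestronglyMeasurable

theorem HasL2Deriv.action_le_of_tendsto {v k : ℕ → ℝ → ℝ} {J : ℝ} (hab : a ≤ b)
    (hg : Continuous g) (hq : LocallyIntegrable q volume) (hv : ∀ n, HasL2Deriv a b (v n) (k n))
    (hu : HasL2Deriv a b u f)
    (hderiv : Tendsto (fun n => ∫ t in a..b, k n t * f t) atTop (𝓝 (∫ t in a..b, f t ^ 2)))
    (hlower : Tendsto (fun n => ∫ t in a..b, lowerOrder g q t (v n t)) atTop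
      (𝓝 (∫ t in a..b, lowerOrder g q t (u t))))
    (hJ : Tendsto (fun n => action g q a b (v n)) atTop (𝓝 J)) : action g q a b u ≤ J := by
  have hlim := (hderiv.sub_const ((1 / 2) * ∫ t in a..b, f t ^ 2)).add hlower
  refine (le_of_tendsto_of_tendsto' hlim hJ fun n => ?_).trans_eq' ?_
  · have hcross := (hv n).intervalIntegrable_mul hu hab
    have hv2 := (hv n).intervalIntegrable_sq hab
    have hsq : 0 ≤ ∫ t in a..b, (k n t - f t) ^ 2 :=
      intervalIntegral.integral_nonneg hab fun t _ => sq_nonneg _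
    have hexpand : ∫ t in a..b, (k n t - f t) ^ 2 = (∫ t in a..b, k n t ^ 2) -
        2 * (∫ t in a..b, k n t * f t) + ∫ t in a..b, f t ^ 2 := by
      rw [← intervalIntegral.integral_const_mul, ← intervalIntegral.integral_sub hv2
        (hcross.const_mul 2), ← intervalIntegral.integral_add (hv2.sub (hcross.const_mul 2))
        (hu.intervalIntegrable_sq hab)]
      exact intervalIntegral.integral_congr fun t _ => by ring
    rw [(hv n).action_eq hab hg hq]
    linarith
  · rw [hu.action_eq hab hg hq]
    ring

theorem zero_mem_H10plus (hab : a ≤ b) : (fun _ => (0 : ℝ)) ∈ H10plus a b :=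
  ⟨⟨(HasL2Deriv.of_hasDerivAt (f := fun _ => 0) continuousOn_const continuousOn_const
    fun t _ => hasDerivAt_const t 0).memH1 hab, rfl, rfl⟩, fun _ _ => le_rfl⟩

theorem bddBelow_action_image (hab : a ≤ b) (hg : Continuous g)
    (hC : ∀ s, 0 ≤ s → |g s| ≤ C) (hq : LocallyIntegrable q volume) :
    BddBelow (action g q a b '' H10plus a b) := by
  refine ⟨-(((∫ t in a..b, (|q t| + C)) + 1) ^ 2 * (b - a)), ?_⟩
  rintro _ ⟨v, hv, rfl⟩
  have hcoercive := (HasL2Deriv.of_memH1 hv.1.1 hab).integral_sq_le_of_action hab hg hC hq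
    hv.1.2.1 hv.2
  have hnonneg : 0 ≤ ∫ t in a..b, deriv v t ^ 2 :=
    intervalIntegral.integral_nonneg hab fun t _ => sq_nonneg _
  linarith

theorem exists_isNonnegMinimizer (hab : a ≤ b) (hg : Continuous g)
    (hC : ∀ s, 0 ≤ s → |g s| ≤ C) (hq : LocallyIntegrable q volume) :
    ∃ u, IsNonnegMinimizer g q a b u := by
  have hbdd := bddBelow_action_image hab hg hC hq
  obtain ⟨J, hJanti, hJlim, hJmem⟩ :=
    exists_seq_tendsto_sInf (Set.Nonempty.image _ ⟨_, zero_mem_H10plus hab⟩) hbdd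
  choose v hv hvJ using hJmem
  have hL : ∀ n, HasL2Deriv a b (v n) (deriv (v n)) := fun n => .of_memH1 (hv n).1.1 hab
  have hD : ∀ n, ∫ t in a..b, deriv (v n) t ^ 2 ≤
      4 * (J 0 + ((∫ t in a..b, (|q t| + C)) + 1) ^ 2 * (b - a)) := fun n => by
    have hcoercive := (hL n).integral_sq_le_of_action hab hg hC hq (hv n).1.2.1 (hv n).2
    linarith [hvJ n, hJanti (Nat.zero_le n)]
  obtain ⟨u, f, φ, hφ, hu, hpt, hderiv⟩ :=
    HasL2Deriv.exists_subseq_tendsto hab hL (fun n => (hv n).1.2.1) hD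
  have hlower := HasL2Deriv.tendsto_integral_lowerOrder hab hg hC hq (fun n => hL (φ n))
    (fun n => (hv (φ n)).1.2.1) (fun n => (hv (φ n)).2) (fun n => hD (φ n)) hpt
  have hle : action g q a b u ≤ sInf (action g q a b '' H10plus a b) :=
    HasL2Deriv.action_le_of_tendsto hab hg hq (fun n => hL (φ n)) hu hderiv hlower <| by
      simpa only [hvJ, Function.comp_def] using hJlim.comp hφ.tendsto_atTop
  have hendpoint : ∀ t ∈ Icc a b, (∀ n, v n t = 0) → u t = 0 := fun t ht h =>
    tendsto_nhds_unique (hpt t ht) (tendsto_const_nhds.congr fun n => (h (φ n)).symm)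
  refine ⟨u, ⟨⟨hu.memH1 hab, hendpoint a (left_mem_Icc.2 hab) fun n => (hv n).1.2.1,
    hendpoint b (right_mem_Icc.2 hab) fun n => (hv n).1.2.2⟩, fun t ht => ?_⟩, fun w hw => ?_⟩
  · exact ge_of_tendsto' (hpt t ht) fun n => (hv (φ n)).2 t ht
  · exact hle.trans (csInf_le hbdd ⟨w, hw, rfl⟩)

end Existence

section Tent

variable {s m e : ℝ}

/-- The piecewise affine function on `[s,e]` with value `1` at `m` and `0` at `s` and `e`; it is
the direction in which a minimizer vanishing at `m` is varied. -/
noncomputable def tent (s m e t : ℝ) : ℝ := min ((t - s) / (m - s)) ((e - t) / (e - m))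

/-- The derivative of `tent`, away from the kink at `m`. -/
noncomputable def tentDeriv (s m e t : ℝ) : ℝ := if t ≤ m then 1 / (m - s) else -(1 / (e - m))

theorem tent_of_le (hsm : s < m) (hme : m < e) {t : ℝ} (ht : t ≤ m) :
    tent s m e t = (t - s) / (m - s) := by
  refine min_eq_left (le_trans (b := 1) ?_ ?_)
  · rw [div_le_one (sub_pos.2 hsm)]; linarith
  · rw [one_le_div (sub_pos.2 hme)]; linarith

theorem tent_of_ge (hsm : s < m) (hme : m < e) {t : ℝ} (ht : m ≤ t) :
    tent s m e t = (e - t) / (e - m) := by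
  refine min_eq_right (le_trans (b := 1) ?_ ?_)
  · rw [div_le_one (sub_pos.2 hme)]; linarith
  · rw [one_le_div (sub_pos.2 hsm)]; linarith

theorem tent_mem_Icc (hsm : s < m) (hme : m < e) {t : ℝ} (ht : t ∈ Icc s e) :
    tent s m e t ∈ Icc 0 1 := by
  refine ⟨le_min (div_nonneg (sub_nonneg.2 ht.1) (sub_pos.2 hsm).le)
    (div_nonneg (sub_nonneg.2 ht.2) (sub_pos.2 hme).le), ?_⟩
  rcases le_total t m with htm | htm
  · exact (min_le_left _ _).trans ((div_le_one (sub_pos.2 hsm)).2 (by linarith))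
  · exact (min_le_right _ _).trans ((div_le_one (sub_pos.2 hme)).2 (by linarith))

theorem tent_left (hsm : s < m) (hme : m < e) : tent s m e s = 0 := by
  simp [tent_of_le hsm hme hsm.le]

theorem tent_right (hsm : s < m) (hme : m < e) : tent s m e e = 0 := by
  simp [tent_of_ge hsm hme hme.le]

theorem hasL2Deriv_tent (hsm : s < m) (hme : m < e) :
    HasL2Deriv s e (tent s m e) (tentDeriv s m e) := by
  refine HasL2Deriv.concat (c := m) hsm.le hme.le
    ((HasL2Deriv.of_hasDerivAt (u := fun t => (t - s) / (m - s)) (f := fun _ => 1 / (m - s))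
      (by fun_prop) (by fun_prop) fun t _ => ((hasDerivAt_id t).sub_const s).div_const _).congr
      (fun t ht => tent_of_le hsm hme ht.2) fun t ht => if_pos ht.2.le)
    ((HasL2Deriv.of_hasDerivAt (u := fun t => (e - t) / (e - m)) (f := fun _ => -(1 / (e - m)))
      (by fun_prop) (by fun_prop) fun t _ => ?_).congr
      (fun t ht => tent_of_ge hsm hme ht.1) fun t ht => if_neg ht.1.not_ge)
  simpa [neg_div] using ((hasDerivAt_id t).const_sub e).div_const (e - m)

theorem integral_mul_tentDeriv (hsm : s < m) (hme : m < e) {f : ℝ → ℝ}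
    (hl : IntervalIntegrable f volume s m) (hr : IntervalIntegrable f volume m e) :
    ∫ t in s..e, f t * tentDeriv s m e t =
      (∫ t in s..m, f t) / (m - s) - (∫ t in m..e, f t) / (e - m) := by
  have hleft : EqOn (fun t => f t * (1 / (m - s))) (fun t => f t * tentDeriv s m e t)
      (uIoc s m) := fun t ht => by
    rw [uIoc_of_le hsm.le] at ht
    simp only [tentDeriv, if_pos ht.2]
  have hright : EqOn (fun t => f t * (-(1 / (e - m)))) (fun t => f t * tentDeriv s m e t)
      (uIoc m e) := fun t ht => by
    rw [uIoc_of_le hme.le] at ht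
    simp only [tentDeriv, if_neg ht.1.not_ge]
  rw [← intervalIntegral.integral_add_adjacent_intervals
      ((hl.mul_const (1 / (m - s))).congr hleft) ((hr.mul_const (-(1 / (e - m)))).congr hright),
    ← intervalIntegral.integral_congr_ae (ae_of_all _ fun t ht => hleft ht),
    ← intervalIntegral.integral_congr_ae (ae_of_all _ fun t ht => hright ht),
    intervalIntegral.integral_mul_const, intervalIntegral.integral_mul_const]
  ring

end Tent

section InteriorZero

variable {g q : ℝ → ℝ} {a b K m : ℝ} {u : ℝ → ℝ}

namespace IsNonnegMinimizer

theorem add_div_le_of_zero (hu : IsNonnegMinimizer g q a b u) (hg : Continuous g)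
    (hm : MonotoneOn g (Ici 0)) (hq : LocallyIntegrable q volume) (hK0 : 0 ≤ K)
    (hK : ∀ᵐ t, ∀ x, 0 ≤ x → q t - g x ≤ K) {s e : ℝ} (hs : a ≤ s) (hsm : s < m)
    (hme : m < e) (he : e ≤ b) (h0 : u m = 0) :
    u s / (m - s) + u e / (e - m) ≤ K * (e - s) := by
  have hse : s ≤ e := (hsm.trans hme).le
  have hU := (hu.hasL2Deriv (hs.trans (hse.trans he))).mono hs he
  have hT := hasL2Deriv_tent hsm hme
  have hvar := hu.firstVariation_nonneg hg hm hq hs hse he hT (tent_left hsm hme)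
    (tent_right hsm hme) fun t ht => (tent_mem_Icc hsm hme ht).1
  have hforce : ∫ t in s..e, (q t - g (u t)) * tent s m e t ≤ ∫ _ in s..e, K := by
    refine intervalIntegral.integral_mono_ae_restrict hse
      (intervalIntegrable_force_mul hg hq hse hU.continuousOn hT.continuousOn)
      intervalIntegrable_const ?_
    filter_upwards [ae_restrict_of_ae hK, ae_restrict_mem measurableSet_Icc] with t ht hts
    obtain ⟨htent0, htent1⟩ := tent_mem_Icc hsm hme hts
    calc (q t - g (u t)) * tent s m e t ≤ K * tent s m e t :=
          mul_le_mul_of_nonneg_right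
            (ht _ (hu.1.2 t ⟨hs.trans hts.1, hts.2.trans he⟩)) htent0
      _ ≤ K := mul_le_of_le_one_right hK0 htent1
  have hsmem : s ∈ Icc s e := left_mem_Icc.2 hse
  have hmmem : m ∈ Icc s e := ⟨hsm.le, hme.le⟩
  have hemem : e ∈ Icc s e := right_mem_Icc.2 hse
  rw [intervalIntegral.integral_const, smul_eq_mul] at hforce
  rw [firstVariation, integral_mul_tentDeriv hsm hme (hU.intervalIntegrable hsmem hmmem)
    (hU.intervalIntegrable hmmem hemem), ← hU.sub_eq_integral hsmem hmmem,
    ← hU.sub_eq_integral hmmem hemem, h0, zero_sub, sub_zero, neg_div] at hvar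
  linarith

theorem le_mul_sq_of_zero (hu : IsNonnegMinimizer g q a b u) (hg : Continuous g)
    (hm : MonotoneOn g (Ici 0)) (hq : LocallyIntegrable q volume) (hK0 : 0 ≤ K)
    (hK : ∀ᵐ t, ∀ x, 0 ≤ x → q t - g x ≤ K) (hmem : m ∈ Ioo a b) (h0 : u m = 0) {x : ℝ}
    (hx : x ∈ Icc a b) : u x ≤ 2 * K * (x - m) ^ 2 := by
  rcases lt_trichotomy x m with hxm | rfl | hmx
  · have hd : 0 < m - x := sub_pos.2 hxm
    have he : m < min b (m + (m - x)) := lt_min hmem.2 (by linarith)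
    have hdiv := hu.add_div_le_of_zero hg hm hq hK0 hK hx.1 hxm he (min_le_left _ _) h0
    have hother : 0 ≤ u (min b (m + (m - x))) / (min b (m + (m - x)) - m) :=
      div_nonneg (hu.1.2 _ ⟨(hmem.1.trans he).le, min_le_left _ _⟩) (sub_pos.2 he).le
    have hlen := mul_le_mul_of_nonneg_left (min_le_right b (m + (m - x))) hK0
    have hle : u x / (m - x) ≤ K * (2 * (m - x)) := by linarith
    rw [div_le_iff₀ hd] at hle
    linarith
  · simp [h0]
  · have hd : 0 < x - m := sub_pos.2 hmx
    have hs : max a (m - (x - m)) < m := max_lt hmem.1 (by linarith)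
    have hdiv := hu.add_div_le_of_zero hg hm hq hK0 hK (le_max_left _ _) hs hmx hx.2 h0
    have hother : 0 ≤ u (max a (m - (x - m))) / (m - max a (m - (x - m))) :=
      div_nonneg (hu.1.2 _ ⟨le_max_left _ _, (hs.trans hmem.2).le⟩) (sub_pos.2 hs).le
    have hlen := mul_le_mul_of_nonneg_left (le_max_right a (m - (x - m))) hK0
    have hle : u x / (x - m) ≤ K * (2 * (x - m)) := by linarith
    rw [div_le_iff₀ hd] at hle
    linarith

end IsNonnegMinimizer

end InteriorZero

section Parabola

/-- The minimizer of `∫ (u̇² / 2 - κ u)` on `(α, β)` with zero boundary values. -/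
noncomputable def parabola (κ α β t : ℝ) : ℝ := κ / 2 * ((t - α) * (β - t))

/-- The derivative of `parabola`. -/
noncomputable def parabolaDeriv (κ α β t : ℝ) : ℝ := κ / 2 * (α + β - 2 * t)

/-- The action `∫ (u̇² / 2 - κ u)` of the asymptotic problem with constant force `κ`, for a
function `u` with derivative `f`. -/
noncomputable def linearAction (κ α β : ℝ) (u f : ℝ → ℝ) : ℝ :=
  (1 / 2) * (∫ t in α..β, f t ^ 2) - κ * ∫ t in α..β, u t

variable {κ α β t : ℝ} {u f : ℝ → ℝ}

theorem hasSecondDerivOn_parabola (κ α β : ℝ) (s : Set ℝ) :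
    HasSecondDerivOn (parabola κ α β) (parabolaDeriv κ α β) (fun _ => -κ) s where
  fst t _ := by
    refine ((((hasDerivAt_id t).sub_const α).mul
      ((hasDerivAt_id t).const_sub β)).const_mul (κ / 2)).congr_deriv ?_
    simp only [parabolaDeriv, id]
    ring
  snd t _ := by
    refine ((((hasDerivAt_id t).const_mul 2).const_sub (α + β)).const_mul (κ / 2)).congr_deriv ?_
    ring

theorem hasL2Deriv_parabola (κ α β : ℝ) :
    HasL2Deriv α β (parabola κ α β) (parabolaDeriv κ α β) :=
  (hasSecondDerivOn_parabola κ α β _).hasL2Deriv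

theorem parabola_left (κ α β : ℝ) : parabola κ α β α = 0 := by simp [parabola]

theorem parabola_right (κ α β : ℝ) : parabola κ α β β = 0 := by simp [parabola]

theorem parabola_add_left (κ α β s : ℝ) :
    parabola κ α β (α + s) = κ / 2 * (s * (β - α - s)) := by
  rw [parabola]
  ring

theorem parabola_sub_right (κ α β s : ℝ) :
    parabola κ α β (β - s) = κ / 2 * (s * (β - α - s)) := by
  rw [parabola]
  ring

theorem parabola_nonneg (hκ : 0 ≤ κ) (ht : t ∈ Icc α β) : 0 ≤ parabola κ α β t :=
  mul_nonneg (div_nonneg hκ zero_le_two) (mul_nonneg (sub_nonneg.2 ht.1) (sub_nonneg.2 ht.2))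

theorem parabolaDeriv_sq_le (ht : t ∈ Icc α β) :
    parabolaDeriv κ α β t ^ 2 ≤ κ ^ 2 * (β - α) ^ 2 := by
  have hslope : ((α + β - 2 * t) / 2) ^ 2 ≤ (β - α) ^ 2 :=
    sq_le_sq' (by linarith [ht.1, ht.2]) (by linarith [ht.1, ht.2])
  calc parabolaDeriv κ α β t ^ 2 = κ ^ 2 * ((α + β - 2 * t) / 2) ^ 2 := by
        rw [parabolaDeriv]; ring
    _ ≤ κ ^ 2 * (β - α) ^ 2 := by gcongr

theorem integral_parabolaDeriv_sq_le (hαβ : α ≤ β) :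
    ∫ t in α..β, parabolaDeriv κ α β t ^ 2 ≤ κ ^ 2 * (β - α) ^ 3 := by
  have hle := intervalIntegral.integral_mono_on hαβ
    ((hasL2Deriv_parabola κ α β).intervalIntegrable_sq hαβ)
    (intervalIntegrable_const (μ := volume)) fun t ht => parabolaDeriv_sq_le ht
  rw [intervalIntegral.integral_const, smul_eq_mul] at hle
  linarith

theorem HasL2Deriv.integral_parabolaDeriv_mul (hu : HasL2Deriv α β u f) (hαβ : α ≤ β)
    (hα : u α = 0) (hβ : u β = 0) :
    ∫ t in α..β, parabolaDeriv κ α β t * f t = κ * ∫ t in α..β, u t := by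
  have hP' : HasL2Deriv α β (parabolaDeriv κ α β) (fun _ => -κ) :=
    .of_hasDerivAt (hasSecondDerivOn_parabola κ α β _).continuousOn_fst continuousOn_const
      fun t _ => (hasSecondDerivOn_parabola κ α β univ).snd t (mem_univ t)
  rw [hP'.integral_mul_deriv_eq hu hαβ, hα, hβ, intervalIntegral.integral_const_mul]
  ring

theorem HasL2Deriv.integral_sub_parabolaDeriv_sq (hu : HasL2Deriv α β u f) (hαβ : α ≤ β)
    (hα : u α = 0) (hβ : u β = 0) :
    (1 / 2) * ∫ t in α..β, (f t - parabolaDeriv κ α β t) ^ 2 =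
      linearAction κ α β u f - linearAction κ α β (parabola κ α β) (parabolaDeriv κ α β) := by
  have hP := hasL2Deriv_parabola κ α β
  have hf2 := hu.intervalIntegrable_sq hαβ
  have hP2 := hP.intervalIntegrable_sq hαβ
  have hcross := hP.intervalIntegrable_mul hu hαβ
  have hPP : ∫ t in α..β, parabolaDeriv κ α β t ^ 2 = κ * ∫ t in α..β, parabola κ α β t := by
    simpa only [sq] using
      hP.integral_parabolaDeriv_mul hαβ (parabola_left κ α β) (parabola_right κ α β)
  have hexpand : ∫ t in α..β, (f t - parabolaDeriv κ α β t) ^ 2 =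
      (∫ t in α..β, f t ^ 2) + (∫ t in α..β, parabolaDeriv κ α β t ^ 2) -
        2 * ∫ t in α..β, parabolaDeriv κ α β t * f t := by
    rw [← intervalIntegral.integral_const_mul, ← intervalIntegral.integral_add hf2 hP2,
      ← intervalIntegral.integral_sub (hf2.add hP2) (hcross.const_mul 2)]
    exact intervalIntegral.integral_congr fun t _ => by ring
  rw [hexpand, hu.integral_parabolaDeriv_mul hαβ hα hβ, linearAction, linearAction, hPP]
  ring

end Parabola

section Remainder

variable {g p q : ℝ → ℝ} {gplus A C : ℝ} {p₂ : ℝ → ℝ → ℝ}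

theorem le_of_tendsto_of_monotoneOn (hm : MonotoneOn g (Ici 0))
    (hlim : Tendsto g atTop (𝓝 gplus)) {s : ℝ} (hs : 0 ≤ s) : g s ≤ gplus :=
  ge_of_tendsto hlim <| (eventually_ge_atTop s).mono fun _ ht => hm hs (hs.trans ht) ht

theorem exists_abs_mul_sub_potential_le (hg : Continuous g) (hm : MonotoneOn g (Ici 0))
    (hlim : Tendsto g atTop (𝓝 gplus)) {ε : ℝ} (hε : 0 < ε) :
    ∃ c : ℝ, 0 ≤ c ∧ ∀ s, 0 ≤ s → |gplus * s - potential g s| ≤ ε * s + c := by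
  obtain ⟨S, hgS, hS⟩ := ((hlim.eventually (lt_mem_nhds (sub_lt_self gplus hε))).and
    (eventually_ge_atTop 0)).exists
  have hle := fun {s : ℝ} (hs : 0 ≤ s) => le_of_tendsto_of_monotoneOn hm hlim hs
  have htangent := fun {x y : ℝ} (hx : 0 ≤ x) (hy : 0 ≤ y) =>
    potential_add_mul_le hg (x := x) (y := y) (hm.mono fun z hz => (le_inf hx hy).trans hz.1)
  have hzero : potential g 0 = 0 := by simp [potential]
  have hg0 : 0 ≤ gplus - g 0 := sub_nonneg.2 (hle le_rfl)
  refine ⟨(gplus - g 0) * S, mul_nonneg hg0 hS, fun s hs => ?_⟩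
  have hnonneg : 0 ≤ gplus * s - potential g s := by
    have := htangent hs le_rfl
    have := mul_le_mul_of_nonneg_right (hle hs) hs
    linarith
  rw [abs_of_nonneg hnonneg]
  rcases le_total s S with hsS | hSs
  · have := htangent le_rfl hs
    have := mul_le_mul_of_nonneg_left hsS hg0
    have := mul_nonneg hε.le hs
    linarith
  · have := htangent le_rfl hS
    have := htangent hS hs
    have := mul_le_mul_of_nonneg_right hgS.le (sub_nonneg.2 hSs)
    have := mul_nonneg hε.le hS
    linarith

theorem ae_abs_le_of_eLpNorm_le {X : Type*} [MeasurableSpace X] {μ : Measure X} {f : X → ℝ}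
    {Q : ℝ≥0∞} (hQ : Q ≠ ∞) (hf : eLpNorm f ∞ μ ≤ Q) : ∀ᵐ x ∂μ, |f x| ≤ Q.toReal := by
  filter_upwards [ae_le_eLpNormEssSup (f := f) (μ := μ)] with x hx
  rw [← eLpNorm_exponent_top] at hx
  simpa using ENNReal.toReal_mono hQ (hx.trans hf)

namespace IsDecomposition

variable {ε α β : ℝ} {q₁ q₂ v f : ℝ → ℝ}

theorem ae_abs_sub_le (h : IsDecomposition q A ε q₁ q₂) (hε : 0 ≤ ε) :
    ∀ᵐ t, |q₁ t - A| ≤ ε / 2 := by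
  simpa only [ENNReal.toReal_ofReal (div_nonneg hε zero_le_two)] using
    ae_abs_le_of_eLpNorm_le ENNReal.ofReal_ne_top h.close.le

theorem abs_integral_sub_mul_le (h : IsDecomposition q A ε q₁ q₂) (hq : MemLp q ∞ volume) {M : ℝ}
    (hM : ∀ᵐ t, |q₂ t| ≤ M) (hv : HasL2Deriv α β v f) (hαβ : α ≤ β) (hα : v α = 0)
    (hβ : v β = 0) : |∫ t in α..β, (q t - q₁ t) * v t| ≤ M * ∫ t in α..β, |f t| := by
  have hq₂ : HasL2Deriv α β q₂ (fun t => q t - q₁ t) :=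
    ⟨((hq.sub h.memLp_fst).restrict _).mono_exponent le_top,
      fun t _ => by linarith [h.primitive α t]⟩
  have hparts := hq₂.integral_mul_deriv_eq hv hαβ
  rw [hα, hβ, mul_zero, mul_zero, sub_zero, zero_sub] at hparts
  rw [← abs_neg, ← hparts, ← intervalIntegral.integral_const_mul, ← Real.norm_eq_abs]
  refine intervalIntegral.norm_integral_le_of_norm_le hαβ ?_
    ((hv.intervalIntegrable_deriv hαβ).abs.const_mul M)
  filter_upwards [hM] with t ht _
  rw [Real.norm_eq_abs, abs_mul]
  exact mul_le_mul_of_nonneg_right ht (abs_nonneg _)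

theorem abs_integral_asymptotic_error_le (h : IsDecomposition q A ε q₁ q₂) (hε : 0 ≤ ε) {c : ℝ}
    (hc : ∀ s, 0 ≤ s → |gplus * s - potential g s| ≤ ε * s + c) (hv : HasL2Deriv α β v f)
    (hαβ : α ≤ β) (hα : v α = 0) (hv0 : ∀ t ∈ Icc α β, 0 ≤ v t) :
    |∫ t in α..β, (gplus * v t - potential g (v t) + (q₁ t - A) * v t)| ≤
      (3 / 2 * ε * (∫ t in α..β, |f t|) + c) * (β - α) := by
  rw [← Real.norm_eq_abs, ← abs_of_nonneg (sub_nonneg.2 hαβ)]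
  refine intervalIntegral.norm_integral_le_of_norm_le_const_ae ?_
  filter_upwards [h.ae_abs_sub_le hε] with t hq₁ ht
  rw [uIoc_of_le hαβ] at ht
  have ht' := Ioc_subset_Icc_self ht
  have hvS := mul_le_mul_of_nonneg_left ((le_abs_self _).trans (hv.abs_le hα ht'))
    (by positivity : 0 ≤ 3 / 2 * ε)
  have hvq₁ := mul_le_mul_of_nonneg_right hq₁ (hv0 t ht')
  calc ‖gplus * v t - potential g (v t) + (q₁ t - A) * v t‖
      ≤ |gplus * v t - potential g (v t)| + |q₁ t - A| * v t := by
        rw [Real.norm_eq_abs]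
        refine (abs_add_le _ _).trans_eq ?_
        rw [abs_mul, abs_of_nonneg (hv0 t ht')]
    _ ≤ 3 / 2 * ε * (∫ t in α..β, |f t|) + c := by linarith [hc _ (hv0 t ht')]

theorem abs_action_sub_linearAction_le (h : IsDecomposition q A ε q₁ q₂) (hε : 0 ≤ ε)
    (hq : MemLp q ∞ volume) {c M : ℝ} (hg : Continuous g)
    (hc : ∀ s, 0 ≤ s → |gplus * s - potential g s| ≤ ε * s + c) (hM : ∀ᵐ t, |q₂ t| ≤ M)
    (hv : HasL2Deriv α β v f) (hαβ : α ≤ β) (hα : v α = 0) (hβ : v β = 0)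
    (hv0 : ∀ t ∈ Icc α β, 0 ≤ v t) :
    |action g q α β v - linearAction (gplus - A) α β v f| ≤
      (3 / 2 * ε * (∫ t in α..β, |f t|) + c) * (β - α) + M * ∫ t in α..β, |f t| := by
  have hql := hq.locallyIntegrable le_top
  have hvc : ContinuousOn v (uIcc α β) := by rw [uIcc_of_le hαβ]; exact hv.continuousOn
  have hq₁ := intervalIntegrable_of_locallyIntegrable (h.memLp_fst.locallyIntegrable le_top) α β
  have hosc : IntervalIntegrable (fun t => (q t - q₁ t) * v t) volume α β :=
    ((intervalIntegrable_of_locallyIntegrable hql α β).sub hq₁).mul_continuousOn hvc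
  have hasym : IntervalIntegrable
      (fun t => gplus * v t - potential g (v t) + (q₁ t - A) * v t) volume α β :=
    ((hvc.intervalIntegrable.const_mul gplus).sub
      ((continuous_potential hg).comp_continuousOn hvc).intervalIntegrable).add
      ((hq₁.sub intervalIntegrable_const).mul_continuousOn hvc)
  have hsplit : action g q α β v - linearAction (gplus - A) α β v f =
      (∫ t in α..β, (gplus * v t - potential g (v t) + (q₁ t - A) * v t)) +
        ∫ t in α..β, (q t - q₁ t) * v t := by
    rw [hv.action_eq hαβ hg hql, linearAction, add_sub_sub_cancel,
      ← intervalIntegral.integral_const_mul, ← intervalIntegral.integral_add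
      (intervalIntegrable_lowerOrder hg hql hαβ hv.continuousOn)
      (hvc.intervalIntegrable.const_mul _), ← intervalIntegral.integral_add hasym hosc]
    refine intervalIntegral.integral_congr fun t _ => ?_
    simp only [lowerOrder]
    ring
  rw [hsplit]
  exact (abs_add_le _ _).trans (add_le_add
    (h.abs_integral_asymptotic_error_le hε hc hv hαβ hα hv0)
    (h.abs_integral_sub_mul_le hq hM hv hαβ hα hβ))

end IsDecomposition

theorem exists_abs_action_sub_linearAction_le (hg : Continuous g) (hm : MonotoneOn g (Ici 0))
    (hlim : Tendsto g atTop (𝓝 gplus)) (hp₂ : ∀ ε ∈ Ioo (0 : ℝ) 1, MemLp (p₂ ε) ∞ volume)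
    {η σ : ℝ} (hη : 0 < η) (hσ : 0 < σ) :
    ∃ l : ℝ, 1 ≤ l ∧ ∀ q ∈ forcingClass p A p₂, ∀ (α β : ℝ) (v f : ℝ → ℝ), l ≤ β - α →
      HasL2Deriv α β v f → v α = 0 → v β = 0 → (∀ t ∈ Icc α β, 0 ≤ v t) →
      ∫ t in α..β, f t ^ 2 ≤ σ ^ 2 * (β - α) ^ 3 →
      |action g q α β v - linearAction (gplus - A) α β v f| ≤ η * (β - α) ^ 3 := by
  set ε := min (1 / 2) (η / (3 * σ))
  have hε : ε ∈ Ioo (0 : ℝ) 1 := ⟨by positivity, (min_le_left _ _).trans_lt (by norm_num)⟩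
  have hεσ : 3 / 2 * ε * σ ≤ η / 2 :=
    calc 3 / 2 * ε * σ ≤ 3 / 2 * (η / (3 * σ)) * σ := by gcongr; exact min_le_right _ _
      _ = η / 2 := by field_simp
  obtain ⟨c, hc0, hc⟩ := exists_abs_mul_sub_potential_le hg hm hlim hε.1
  have hfin : eLpNorm (p₂ ε) ∞ volume + 1 ≠ ∞ :=
    ENNReal.add_ne_top.2 ⟨(hp₂ ε hε).2.ne, ENNReal.one_ne_top⟩
  set M := (eLpNorm (p₂ ε) ∞ volume + 1).toReal
  have hM0 : 0 ≤ M := ENNReal.toReal_nonneg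
  refine ⟨max 1 (2 * (c + M * σ) / η), le_max_left _ _, ?_⟩
  rintro q ⟨hq, -, -, hdec⟩ α β v f hlen hv hα hβ hv0 henergy
  obtain ⟨q₁, q₂, hd, hq₂⟩ := hdec ε hε
  have hone : 1 ≤ β - α := (le_max_left _ _).trans hlen
  have hlength : c + M * σ ≤ η / 2 * (β - α) := by
    have := (div_le_iff₀ hη).1 ((le_max_right _ _).trans hlen)
    linarith
  have hS := hv.integral_abs_deriv_le_mul_sq (by linarith) hσ henergy
  calc |action g q α β v - linearAction (gplus - A) α β v f|
      ≤ (3 / 2 * ε * (∫ t in α..β, |f t|) + c) * (β - α) + M * ∫ t in α..β, |f t| :=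
        hd.abs_action_sub_linearAction_le hε.1.le hq hg hc (ae_abs_le_of_eLpNorm_le hfin hq₂.le)
          hv (by linarith) hα hβ hv0
    _ ≤ (3 / 2 * ε * (σ * (β - α) ^ 2) + c) * (β - α) + M * (σ * (β - α) ^ 2) := by
        have := hε.1
        gcongr
    _ = 3 / 2 * ε * σ * (β - α) ^ 3 + (c * 1 * (β - α) + M * σ * (β - α) ^ 2) := by ring
    _ ≤ η / 2 * (β - α) ^ 3 + (c * (β - α) * (β - α) + M * σ * (β - α) ^ 2) := by gcongr
    _ = η / 2 * (β - α) ^ 3 + (c + M * σ) * (β - α) ^ 2 := by ring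
    _ ≤ η / 2 * (β - α) ^ 3 + η / 2 * (β - α) * (β - α) ^ 2 := by gcongr
    _ = η * (β - α) ^ 3 := by ring

end Remainder

section Threshold

variable {g p q : ℝ → ℝ} {gplus A C : ℝ} {p₂ : ℝ → ℝ → ℝ} {α β : ℝ} {u f : ℝ → ℝ}

theorem HasL2Deriv.integral_sq_le_of_action_nonpos (hu : HasL2Deriv α β u f) (hlen : 1 ≤ β - α)
    (hg : Continuous g) (hC : ∀ s, 0 ≤ s → |g s| ≤ C) (hq : LocallyIntegrable q volume) {Q : ℝ}
    (hQ : ∀ᵐ t, |q t| ≤ Q) (hα : u α = 0) (hu0 : ∀ t ∈ Icc α β, 0 ≤ u t)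
    (hact : action g q α β u ≤ 0) :
    ∫ t in α..β, f t ^ 2 ≤ (2 * (Q + C + 1)) ^ 2 * (β - α) ^ 3 := by
  have hαβ : α ≤ β := by linarith
  have hC0 : 0 ≤ C := (abs_nonneg _).trans (hC 0 le_rfl)
  have hforce : ∫ t in α..β, (|q t| + C) ≤ (Q + C) * (β - α) := by
    have hle := intervalIntegral.integral_mono_ae hαβ
      ((intervalIntegrable_of_locallyIntegrable hq α β).abs.add intervalIntegrable_const)
      (intervalIntegrable_const (c := Q + C))
      (hQ.mono fun t ht => add_le_add_left ht C)
    rwa [intervalIntegral.integral_const, smul_eq_mul, mul_comm] at hle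
  have hforce0 : 0 ≤ ∫ t in α..β, (|q t| + C) :=
    intervalIntegral.integral_nonneg hαβ fun t _ => by positivity
  calc ∫ t in α..β, f t ^ 2
      ≤ 4 * (action g q α β u + ((∫ t in α..β, (|q t| + C)) + 1) ^ 2 * (β - α)) :=
        hu.integral_sq_le_of_action hαβ hg hC hq hα hu0
    _ ≤ 4 * (0 + ((Q + C) * (β - α) + (β - α)) ^ 2 * (β - α)) := by gcongr
    _ = (2 * (Q + C + 1)) ^ 2 * (β - α) ^ 3 := by ring

theorem HasL2Deriv.abs_sub_parabola_le (hu : HasL2Deriv α β u f) (hαβ : α < β) {κ ρ : ℝ}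
    (hρ : 0 < ρ) (hα : u α = 0) (hβ : u β = 0)
    (hact : action g q α β u ≤ action g q α β (parabola κ α β))
    (hRu : |action g q α β u - linearAction κ α β u f| ≤ ρ ^ 2 / 4 * (β - α) ^ 3)
    (hRP : |action g q α β (parabola κ α β) -
      linearAction κ α β (parabola κ α β) (parabolaDeriv κ α β)| ≤ ρ ^ 2 / 4 * (β - α) ^ 3)
    {t : ℝ} (ht : t ∈ Icc α β) : |u t - parabola κ α β t| ≤ ρ * (β - α) ^ 2 := by
  have hsub := hu.sub (hasL2Deriv_parabola κ α β)
  have henergy : ∫ t in α..β, (f t - parabolaDeriv κ α β t) ^ 2 ≤ ρ ^ 2 * (β - α) ^ 3 := by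
    have := hu.integral_sub_parabolaDeriv_sq (κ := κ) hαβ.le hα hβ
    linarith [(_root_.abs_le.1 hRu).1, (_root_.abs_le.1 hRP).2]
  exact (hsub.abs_le (by rw [hα, parabola_left, sub_zero]) ht).trans
    (hsub.integral_abs_deriv_le_mul_sq hαβ hρ henergy)

theorem IsNonnegMinimizer.action_nonpos_of_zero {a b : ℝ} (hu : IsNonnegMinimizer g q a b u)
    (hg : Continuous g) (hq : LocallyIntegrable q volume) (hα : a ≤ α) (hαβ : α ≤ β) (hβ : β ≤ b)
    (huα : u α = 0) (huβ : u β = 0) : action g q α β u ≤ 0 := by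
  simpa [action] using hu.action_le_action hg hq hα hαβ hβ
    (.of_hasDerivAt continuousOn_const continuousOn_const fun t _ => hasDerivAt_const t 0)
    huα.symm huβ.symm fun _ _ => le_rfl

theorem IsNonnegMinimizer.exists_abs_sub_parabola_le (hg : Continuous g)
    (hm : MonotoneOn g (Ici 0)) (hC : ∀ s, 0 ≤ s → |g s| ≤ C) (hlim : Tendsto g atTop (𝓝 gplus))
    (hA : A < gplus) (hp : MemLp p ∞ volume) (hp₂ : ∀ ε ∈ Ioo (0 : ℝ) 1, MemLp (p₂ ε) ∞ volume)
    {ρ : ℝ} (hρ : 0 < ρ) :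
    ∃ l : ℝ, 1 ≤ l ∧ ∀ q ∈ forcingClass p A p₂, ∀ a b u, IsNonnegMinimizer g q a b u →
      ∀ α β, a ≤ α → β ≤ b → l ≤ β - α → u α = 0 → u β = 0 → ∀ t ∈ Icc α β,
      |u t - parabola (gplus - A) α β t| ≤ ρ * (β - α) ^ 2 := by
  set κ := gplus - A
  have hκ : 0 < κ := sub_pos.2 hA
  set Q := (eLpNorm p ∞ volume + 1).toReal
  have hQ0 : 0 ≤ Q := ENNReal.toReal_nonneg
  have hC0 : 0 ≤ C := (abs_nonneg _).trans (hC 0 le_rfl)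
  obtain ⟨l, hl1, hl⟩ := exists_abs_action_sub_linearAction_le (p := p) (A := A) hg hm hlim hp₂
    (η := ρ ^ 2 / 4) (σ := 2 * (Q + C + 1) + κ) (by positivity) (by positivity)
  refine ⟨l, hl1, fun q hq a b u hu α β hα hβ hlen huα huβ t ht => ?_⟩
  have hαβ : α < β := by linarith
  have hab : a ≤ b := hα.trans (hαβ.le.trans hβ)
  have hu0 : ∀ t ∈ Icc α β, 0 ≤ u t := fun t ht => hu.1.2 t (Icc_subset_Icc hα hβ ht)
  have hU := (hu.hasL2Deriv hab).mono hα hβ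
  have hP := hasL2Deriv_parabola κ α β
  have hP0 : ∀ t ∈ Icc α β, 0 ≤ parabola κ α β t := fun t ht => parabola_nonneg hκ.le ht
  have hql := hq.1.locallyIntegrable le_top
  have hQ := ae_abs_le_of_eLpNorm_le
    (ENNReal.add_ne_top.2 ⟨hp.2.ne, ENNReal.one_ne_top⟩) hq.2.1.le
  have hleP := hu.action_le_action hg hql hα hαβ.le hβ hP (by rw [parabola_left, huα])
    (by rw [parabola_right, huβ]) hP0
  have hlen3 : 0 ≤ (β - α) ^ 3 := pow_nonneg (sub_nonneg.2 hαβ.le) 3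
  have hDu := (hU.integral_sq_le_of_action_nonpos (hl1.trans hlen) hg hC hql hQ huα hu0
    (hu.action_nonpos_of_zero hg hql hα hαβ.le hβ huα huβ)).trans (mul_le_mul_of_nonneg_right
      (pow_le_pow_left₀ (by positivity) (le_add_of_nonneg_right hκ.le) 2) hlen3)
  have hDP := (integral_parabolaDeriv_sq_le (κ := κ) hαβ.le).trans (mul_le_mul_of_nonneg_right
    (pow_le_pow_left₀ hκ.le (le_add_of_nonneg_left (by positivity : 0 ≤ 2 * (Q + C + 1))) 2) hlen3)
  exact hU.abs_sub_parabola_le hαβ hρ huα huβ hleP (hl q hq α β u _ hlen hU huα huβ hu0 hDu)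
    (hl q hq α β _ _ hlen hP (parabola_left κ α β) (parabola_right κ α β) hP0 hDP) ht

theorem lt_abs_sub_parabola {κ K θ d x : ℝ} (hκ : 0 < κ) (hκK : κ ≤ K) (hθ : θ = κ / (16 * K))
    (hd : 0 < d) (hx : x ≤ 2 * K * (θ * d) ^ 2) :
    κ * θ / 16 * d ^ 2 < |x - κ / 2 * (θ * d * (d - θ * d))| := by
  have hK : 0 < K := hκ.trans_le hκK
  have hθ0 : 0 < θ := by rw [hθ]; positivity
  have hθK : θ * K = κ / 16 := by rw [hθ]; field_simp
  have hθ1 : θ ≤ 1 / 16 := by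
    rw [hθ, div_le_div_iff₀ (by positivity) (by norm_num)]
    linarith
  have hquad : 2 * K * (θ * d) ^ 2 = κ / 8 * (θ * d ^ 2) := by
    rw [show 2 * K * (θ * d) ^ 2 = 2 * (θ * K) * (θ * d ^ 2) by ring, hθK]
    ring
  have hpos : 0 < κ * (θ * d ^ 2) := by positivity
  have hsmall := mul_le_mul_of_nonneg_right hθ1 hpos.le
  refine lt_of_lt_of_le ?_ (neg_le_abs _)
  linarith

theorem IsNonnegMinimizer.pos_of_abs_sub_parabola_le {a b κ K θ l m : ℝ}
    (hu : IsNonnegMinimizer g q a b u) (hg : Continuous g) (hm : MonotoneOn g (Ici 0))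
    (hq : LocallyIntegrable q volume) (hqK : ∀ᵐ t, ∀ x, 0 ≤ x → q t - g x ≤ K) (hκ : 0 < κ)
    (hκK : κ ≤ K) (hθ : θ = κ / (16 * K)) (hab : 2 * l ≤ b - a)
    (hclose : ∀ α β, a ≤ α → β ≤ b → l ≤ β - α → u α = 0 → u β = 0 → ∀ t ∈ Icc α β,
      |u t - parabola κ α β t| ≤ κ * θ / 16 * (β - α) ^ 2) (hmab : m ∈ Ioo a b) : 0 < u m := by
  have hK : 0 < K := hκ.trans_le hκK
  have hθ0 : 0 < θ := by rw [hθ]; positivity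
  have hθ1 : θ ≤ 1 := by
    rw [hθ, div_le_one (by positivity)]
    linarith
  refine (hu.1.2 m (Ioo_subset_Icc_self hmab)).lt_of_ne' fun h0 => ?_
  have hquad := fun x (hx : x ∈ Icc a b) => hu.le_mul_sq_of_zero hg hm hq hK.le hqK hmab h0 hx
  rcases le_total ((b - a) / 2) (b - m) with hside | hside
  · have hd : 0 < b - m := sub_pos.2 hmab.2
    have hx : m + θ * (b - m) ∈ Icc m b :=
      ⟨le_add_of_nonneg_right (by positivity), by linarith [mul_le_of_le_one_left hd.le hθ1]⟩
    have hcl := hclose m b hmab.1.le le_rfl (by linarith) h0 hu.1.1.2.2 _ hx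
    have hle := hquad _ (Icc_subset_Icc_left hmab.1.le hx)
    rw [add_sub_cancel_left] at hle
    rw [parabola_add_left] at hcl
    exact (lt_abs_sub_parabola hκ hκK hθ hd hle).not_ge hcl
  · have hd : 0 < m - a := sub_pos.2 hmab.1
    have hx : m - θ * (m - a) ∈ Icc a m :=
      ⟨by linarith [mul_le_of_le_one_left hd.le hθ1], sub_le_self _ (by positivity)⟩
    have hcl := hclose a m le_rfl hmab.2.le (by linarith) hu.1.1.2.1 h0 _ hx
    have hle := hquad _ (Icc_subset_Icc_right hmab.2.le hx)
    rw [sub_sub_cancel_left, neg_sq] at hle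
    rw [parabola_sub_right] at hcl
    exact (lt_abs_sub_parabola hκ hκK hθ hd hle).not_ge hcl

theorem exists_isThreshold (hg : Continuous g) (hm : MonotoneOn g (Ici 0))
    (hC : ∀ s, 0 ≤ s → |g s| ≤ C) (hlim : Tendsto g atTop (𝓝 gplus)) (hA : A < gplus)
    (hp : MemLp p ∞ volume) (hp₂ : ∀ ε ∈ Ioo (0 : ℝ) 1, MemLp (p₂ ε) ∞ volume) :
    ∃ L, IsThreshold g (forcingClass p A p₂) L := by
  set κ := gplus - A
  have hκ : 0 < κ := sub_pos.2 hA
  set Q := (eLpNorm p ∞ volume + 1).toReal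
  have hQ0 : 0 ≤ Q := ENNReal.toReal_nonneg
  have hC0 : 0 ≤ C := (abs_nonneg _).trans (hC 0 le_rfl)
  set K := C + Q + κ
  obtain ⟨l, hl1, hl⟩ := IsNonnegMinimizer.exists_abs_sub_parabola_le hg hm hC hlim hA hp hp₂
    (ρ := κ * (κ / (16 * K)) / 16) (by positivity)
  refine ⟨2 * l, by linarith, fun a b hab q hq u hu m hmab => ?_⟩
  have hqK : ∀ᵐ t, ∀ x, 0 ≤ x → q t - g x ≤ K := by
    filter_upwards [ae_abs_le_of_eLpNorm_le
      (ENNReal.add_ne_top.2 ⟨hp.2.ne, ENNReal.one_ne_top⟩) hq.2.1.le] with t ht x hx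
    linarith [le_abs_self (q t), neg_abs_le (g x), hC x hx]
  exact hu.pos_of_abs_sub_parabola_le hg hm (hq.1.locallyIntegrable le_top) hqK hκ
    (by linarith) rfl hab (hl q hq a b u hu) hmab

end Threshold

section Sturm

variable {a b : ℝ} {w w' w'' z z' z'' c : ℝ → ℝ}

theorem exists_nodal_interval {t₀ : ℝ} (hz : ContinuousOn z (Icc a b)) (ha : z a = 0)
    (hb : z b = 0) (ht₀ : t₀ ∈ Icc a b) (hpos : 0 < z t₀) :
    ∃ α β, a ≤ α ∧ α < β ∧ β ≤ b ∧ z α = 0 ∧ z β = 0 ∧ ∀ t ∈ Ioo α β, 0 < z t := by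
  have hl := hz.mono (Icc_subset_Icc_right ht₀.2)
  have hr := hz.mono (Icc_subset_Icc_left ht₀.1)
  obtain ⟨α, ⟨hα, hzα : z α = 0⟩, hαmax⟩ := (isCompact_Icc.of_isClosed_subset
    (hl.preimage_isClosed_of_isClosed isClosed_Icc (isClosed_singleton (x := 0)))
    inter_subset_left).exists_isGreatest ⟨a, left_mem_Icc.2 ht₀.1, ha⟩
  obtain ⟨β, ⟨hβ, hzβ : z β = 0⟩, hβmin⟩ := (isCompact_Icc.of_isClosed_subset
    (hr.preimage_isClosed_of_isClosed isClosed_Icc (isClosed_singleton (x := 0)))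
    inter_subset_left).exists_isLeast ⟨b, right_mem_Icc.2 ht₀.2, hb⟩
  have hαt₀ : α < t₀ := hα.2.lt_of_ne fun h => hpos.ne' (h ▸ hzα)
  have ht₀β : t₀ < β := hβ.1.lt_of_ne' fun h => hpos.ne' (h ▸ hzβ)
  refine ⟨α, β, hα.1, hαt₀.trans ht₀β, hβ.2, hzα, hzβ, fun t ht => ?_⟩
  by_contra! hneg
  rcases le_total t t₀ with h | h
  · obtain ⟨s, hs, hs0⟩ := intermediate_value_Icc h
      (hl.mono (Icc_subset_Icc_left (hα.1.trans ht.1.le))) ⟨hneg, hpos.le⟩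
    exact (ht.1.trans_le hs.1).not_ge (hαmax ⟨⟨(hα.1.trans ht.1.le).trans hs.1, hs.2⟩, hs0⟩)
  · obtain ⟨s, hs, hs0⟩ := intermediate_value_Icc' h
      (hr.mono (Icc_subset_Icc_right (ht.2.le.trans hβ.2))) ⟨hneg, hpos.le⟩
    exact (hs.2.trans_lt ht.2).not_ge (hβmin ⟨⟨hs.1, hs.2.trans (ht.2.le.trans hβ.2)⟩, hs0⟩)

theorem mul_sub_nonneg_of_isMinOn {f : ℝ → ℝ} {f' x y : ℝ} {s : Set ℝ} (hs : Convex ℝ s)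
    (h : IsMinOn f s x) (hf : HasDerivAt f f' x) (hx : x ∈ s) (hy : y ∈ s) :
    0 ≤ (y - x) * f' := by
  simpa using h.localize.hasFDerivWithinAt_nonneg hf.hasFDerivAt.hasFDerivWithinAt
    (sub_mem_posTangentConeAt_of_segment_subset (hs.segment_subset hx hy))

namespace HasSecondDerivOn

theorem wronskian_lt (hab : a < b) (hw : HasSecondDerivOn w w' w'' (Icc a b))
    (hz : HasSecondDerivOn z z' z'' (Icc a b))
    (h : ∀ t ∈ Ioo a b, w'' t * z t - w t * z'' t < 0) :
    w' b * z b - w b * z' b < w' a * z a - w a * z' a := by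
  have hderiv : ∀ t ∈ Icc a b, HasDerivAt (fun t => w' t * z t - w t * z' t)
      (w'' t * z t - w t * z'' t) t := fun t ht =>
    (((hw.snd t ht).mul (hz.fst t ht)).sub ((hw.fst t ht).mul (hz.snd t ht))).congr_deriv
      (by ring)
  refine strictAntiOn_of_deriv_neg (convex_Icc a b)
    (fun t ht => (hderiv t ht).continuousAt.continuousWithinAt) (fun t ht => ?_)
    (left_mem_Icc.2 hab.le) (right_mem_Icc.2 hab.le) hab
  rw [interior_Icc] at ht
  rw [(hderiv t (Ioo_subset_Icc_self ht)).deriv]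
  exact h t ht

theorem nonpos_of_strict_supersolution (hw : HasSecondDerivOn w w' w'' (Icc a b))
    (hz : HasSecondDerivOn z z' z'' (Icc a b)) (hw0 : ∀ t ∈ Icc a b, 0 ≤ w t) (ha : z a = 0)
    (hb : z b = 0)
    (hc : ∀ t ∈ Ioo a b, 0 < z t → w'' t + c t * w t < 0 ∧ 0 ≤ z'' t + c t * z t)
    {t : ℝ} (ht : t ∈ Icc a b) : z t ≤ 0 := by
  by_contra! hpos
  obtain ⟨α, β, hα, hαβ, hβ, hzα, hzβ, hzpos⟩ :=
    exists_nodal_interval hz.continuousOn ha hb ht hpos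
  have hsub := Icc_subset_Icc hα hβ
  have hleft := left_mem_Icc.2 hαβ.le
  have hright := right_mem_Icc.2 hαβ.le
  have hwronskian := wronskian_lt hαβ (hw.mono hsub) (hz.mono hsub) fun t ht => by
    have hz0 := hzpos t ht
    obtain ⟨hcw, hcz⟩ := hc t (Ioo_subset_Ioo hα hβ ht) hz0
    have := mul_neg_of_neg_of_pos hcw hz0
    have := mul_nonneg (hw0 t (hsub (Ioo_subset_Icc_self ht))) hcz
    linarith
  have hz0 : ∀ t ∈ Icc α β, 0 ≤ z t := fun t ht => by
    rcases ht.1.eq_or_lt with rfl | hlt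
    · exact hzα.ge
    rcases ht.2.eq_or_lt with rfl | hlt'
    · exact hzβ.ge
    exact (hzpos t ⟨hlt, hlt'⟩).le
  have hz'α : 0 ≤ (β - α) * z' α := mul_sub_nonneg_of_isMinOn (convex_Icc α β)
    (fun t ht => hzα.trans_le (hz0 t ht)) (hz.fst α (hsub hleft)) hleft hright
  have hz'β : 0 ≤ (α - β) * z' β := mul_sub_nonneg_of_isMinOn (convex_Icc α β)
    (fun t ht => hzβ.trans_le (hz0 t ht)) (hz.fst β (hsub hright)) hright hleft
  have hα' : 0 ≤ w α * z' α := mul_nonneg (hw0 α (hsub hleft))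
    ((mul_nonneg_iff_of_pos_left (sub_pos.2 hαβ)).1 hz'α)
  have hβ' : w β * z' β ≤ 0 := mul_nonpos_of_nonneg_of_nonpos (hw0 β (hsub hright))
    (by nlinarith)
  rw [hzα, hzβ] at hwronskian
  linarith

end HasSecondDerivOn

end Sturm
section Comparison

variable {g q u v : ℝ → ℝ} {a b δ : ℝ}

theorem HasL2Deriv.action_add_const {f : ℝ → ℝ} (hu : HasL2Deriv a b u f) (hab : a ≤ b)
    (hg : Continuous g) (hq : LocallyIntegrable q volume) (δ : ℝ) :
    action g (fun t => q t + δ) a b u = action g q a b u + δ * ∫ t in a..b, u t := by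
  have hqδ : LocallyIntegrable (fun t => q t + δ) volume := hq.add (locallyIntegrable_const δ)
  have hui := hu.continuousOn.intervalIntegrable_of_Icc (μ := volume) hab
  rw [hu.action_eq hab hg hq, hu.action_eq hab hg hqδ, add_assoc,
    ← intervalIntegral.integral_const_mul δ u, ← intervalIntegral.integral_add
      (intervalIntegrable_lowerOrder hg hq hab hu.continuousOn) (hui.const_mul δ)]
  congr 1
  exact intervalIntegral.integral_congr fun t _ => by simp only [lowerOrder]; ring

namespace IsNonnegMinimizer

theorem le_of_add_const (hu : IsNonnegMinimizer g q a b u)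
    (hv : IsNonnegMinimizer g (fun t => q t + δ) a b v) (hδ : 0 < δ) (hg : Continuous g)
    (hq : LocallyIntegrable q volume) {t : ℝ} (ht : t ∈ Icc a b) : v t ≤ u t := by
  by_contra! hlt
  have hab := ht.1.trans ht.2
  have hqδ : LocallyIntegrable (fun t => q t + δ) volume := hq.add (locallyIntegrable_const δ)
  have hU := hu.hasL2Deriv hab
  have hV := hv.hasL2Deriv hab
  obtain ⟨α, β, hα, hαβ, hβ, hzα, hzβ, hpos⟩ := exists_nodal_interval (z := fun t => v t - u t)
    (hV.continuousOn.sub hU.continuousOn) (by simp [hu.1.1.2.1, hv.1.1.2.1])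
    (by simp [hu.1.1.2.2, hv.1.1.2.2]) ht (sub_pos.2 hlt)
  have hvuα := sub_eq_zero.1 hzα
  have hvuβ := sub_eq_zero.1 hzβ
  have hsub := Icc_subset_Icc hα hβ
  have hUαβ := hU.mono hα hβ
  have hVαβ := hV.mono hα hβ
  have hu_le := hu.action_le_action hg hq hα hαβ.le hβ hVαβ hvuα hvuβ fun t ht =>
    hv.1.2 t (hsub ht)
  have hv_le := hv.action_le_action hg hqδ hα hαβ.le hβ hUαβ hvuα.symm hvuβ.symm fun t ht =>
    hu.1.2 t (hsub ht)
  rw [hVαβ.action_add_const hαβ.le hg hq, hUαβ.action_add_const hαβ.le hg hq] at hv_le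
  have hui := hUαβ.continuousOn.intervalIntegrable_of_Icc (μ := volume) hαβ.le
  have hvi := hVαβ.continuousOn.intervalIntegrable_of_Icc (μ := volume) hαβ.le
  have hintegral : 0 < ∫ t in α..β, (v t - u t) :=
    intervalIntegral.intervalIntegral_pos_of_pos_on (hvi.sub hui) hpos hαβ
  rw [intervalIntegral.integral_sub hvi hui] at hintegral
  have := mul_pos hδ hintegral
  linarith

theorem nonpos_of_le_secant {z z' z'' c : ℝ → ℝ} (hu : IsNonnegMinimizer g q a b u)
    (hupos : ∀ t ∈ Ioo a b, 0 < u t) (hv : IsNonnegMinimizer g (fun t => q t + δ) a b v)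
    (hvpos : ∀ t ∈ Ioo a b, 0 < v t) (hδ : 0 < δ) (hg : Continuous g)
    (hm : MonotoneOn g (Ici 0)) (hq : Continuous q) (hab : a < b)
    (hz : HasSecondDerivOn z z' z'' (Icc a b)) (hza : z a = 0) (hzb : z b = 0)
    (hc : ∀ t ∈ Ioo a b, 0 < z t →
      c t * (u t - v t) ≤ g (u t) - g (v t) ∧ 0 ≤ z'' t + c t * z t)
    {t : ℝ} (ht : t ∈ Icc a b) : z t ≤ 0 := by
  obtain ⟨U, U', hU, hU''⟩ := hu.exists_hasSecondDerivOn hg hm hq hab hupos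
  obtain ⟨V, V', hV, hV''⟩ :=
    hv.exists_hasSecondDerivOn hg hm (hq.add continuous_const) hab hvpos
  refine (hU''.sub hV'').nonpos_of_strict_supersolution (c := c) hz (fun t ht => ?_) hza hzb
    (fun t ht hzt => ?_) ht
  · rw [hU ht, hV ht]
    exact sub_nonneg.2 (hu.le_of_add_const hv hδ hg hq.locallyIntegrable ht)
  · obtain ⟨hsecant, hcz⟩ := hc t ht hzt
    refine ⟨?_, hcz⟩
    rw [hU (Ioo_subset_Icc_self ht), hV (Ioo_subset_Icc_self ht)]
    linarith

theorem le_of_pos {u₁ : ℝ → ℝ} (hu : IsNonnegMinimizer g q a b u)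
    (hupos : ∀ t ∈ Ioo a b, 0 < u t) (hu₁ : IsNonnegMinimizer g q a b u₁)
    (hu₁pos : ∀ t ∈ Ioo a b, 0 < u₁ t) (hv : IsNonnegMinimizer g (fun t => q t + δ) a b v)
    (hvpos : ∀ t ∈ Ioo a b, 0 < v t) (hδ : 0 < δ) (hg : Continuous g)
    (hm : MonotoneOn g (Ici 0)) (hconc : ConcaveOn ℝ (Ioi 0) g) (hq : Continuous q) (hab : a < b)
    {t : ℝ} (ht : t ∈ Icc a b) : u₁ t ≤ u t := by
  obtain ⟨U, U', hU, hU''⟩ := hu.exists_hasSecondDerivOn hg hm hq hab hupos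
  obtain ⟨U₁, U₁', hU₁, hU₁''⟩ := hu₁.exists_hasSecondDerivOn hg hm hq hab hu₁pos
  have ha := left_mem_Icc.2 hab.le
  have hb := right_mem_Icc.2 hab.le
  rw [← sub_nonpos, ← hU ht, ← hU₁ ht]
  refine hu.nonpos_of_le_secant hupos hv hvpos hδ hg hm hq hab (hU₁''.sub hU'')
    (c := fun t => (g (u₁ t) - g (u t)) / (u₁ t - u t))
    (by rw [hU ha, hU₁ ha, hu.1.1.2.1, hu₁.1.1.2.1, sub_zero])
    (by rw [hU hb, hU₁ hb, hu.1.1.2.2, hu₁.1.1.2.2, sub_zero]) (fun t ht hzt => ?_) ht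
  have htc := Ioo_subset_Icc_self ht
  rw [hU htc, hU₁ htc] at hzt ⊢
  refine ⟨?_, by rw [div_mul_cancel₀ _ hzt.ne']; linarith⟩
  rcases (hu.le_of_add_const hv hδ hg hq.locallyIntegrable htc).eq_or_lt with hvu | hvu
  · simp [hvu]
  · exact (le_div_iff₀ (sub_pos.2 hvu)).1
      (hconc.slope_anti_adjacent (hvpos t ht) (hu₁pos t ht) hvu (sub_pos.1 hzt))

end IsNonnegMinimizer

end Comparison

section Nondegeneracy

variable {g q u v : ℝ → ℝ} {a b δ : ℝ}

theorem HasL2Deriv.eqOn_of_deriv_ae_eq {f h : ℝ → ℝ} (hu : HasL2Deriv a b u f)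
    (hv : HasL2Deriv a b v h) (ha : u a = v a) (hfh : f =ᵐ[volume.restrict (Ioo a b)] h) :
    EqOn u v (Icc a b) := by
  intro t ht
  rw [hu.eq_integral t ht, hv.eq_integral t ht, ha]
  congr 1
  refine intervalIntegral.integral_congr_ae_restrict ?_
  rw [uIoc_of_le ht.1, ← restrict_Ioo_eq_restrict_Ioc]
  exact ae_mono (Measure.restrict_mono (Ioo_subset_Ioo_right ht.2) le_rfl) hfh

theorem MemH2.exists_hasSecondDerivOn {ψ F : ℝ → ℝ} (hab : a ≤ b) (hψ : MemH2 a b ψ)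
    (hF : ContinuousOn F (Icc a b))
    (hψF : deriv (deriv ψ) =ᵐ[volume.restrict (Ioo a b)] F) :
    ∃ Ψ Ψ' : ℝ → ℝ, EqOn Ψ ψ (Icc a b) ∧ HasSecondDerivOn Ψ Ψ' F (Icc a b) := by
  obtain ⟨hψc, y, hy, hψy⟩ := hψ
  obtain ⟨Ψ, Ψ', hΨ, hΨa, hΨ'a⟩ := DualNehari.exists_hasSecondDerivOn hab hF (ψ a) (y a)
  have hY := HasL2Deriv.of_memH1 hy hab
  have hyF : deriv y =ᵐ[volume.restrict (Ioo a b)] F := by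
    filter_upwards [hψF, ae_restrict_mem measurableSet_Ioo] with t ht htab
    have hderiv : deriv ψ =ᶠ[𝓝 t] y :=
      eventually_of_mem (Ioo_mem_nhds htab.1 htab.2) fun s hs => (hψy s hs).deriv
    rwa [hderiv.deriv_eq] at ht
  have hΨ'F : HasL2Deriv a b Ψ' F := .of_hasDerivAt hΨ.continuousOn_fst hF fun t ht =>
    hΨ.snd t (Ioo_subset_Icc_self ht)
  have hΨ'y : EqOn Ψ' y (Icc a b) := hΨ'F.eqOn_of_deriv_ae_eq hY hΨ'a hyF.symm
  exact ⟨Ψ, Ψ', hΨ.hasL2Deriv.eqOn_of_deriv_ae_eq (.of_hasDerivAt hψc hY.continuousOn hψy) hΨa <|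
    (ae_restrict_mem measurableSet_Ioo).mono fun t ht => hΨ'y (Ioo_subset_Icc_self ht), hΨ⟩

theorem IsNonnegMinimizer.isNondegenerate_of_pos (hu : IsNonnegMinimizer g q a b u)
    (hupos : ∀ t ∈ Ioo a b, 0 < u t) (hv : IsNonnegMinimizer g (fun t => q t + δ) a b v)
    (hvpos : ∀ t ∈ Ioo a b, 0 < v t) (hδ : 0 < δ) (hg : ContDiff ℝ 1 g)
    (hm : MonotoneOn g (Ici 0)) (hconc : ConcaveOn ℝ (Ioi 0) g) (hq : Continuous q)
    (hab : a < b) : IsNondegenerate g a b u := by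
  intro ψ hψ hψ0 hψeq t ht
  have hF : ContinuousOn (fun t => -(deriv g (u t) * ψ t)) (Icc a b) :=
    (((hg.continuous_deriv le_rfl).comp_continuousOn (hu.hasL2Deriv hab.le).continuousOn).mul
      hψ.1).neg
  obtain ⟨Ψ, Ψ', hΨ, hΨ''⟩ := hψ.exists_hasSecondDerivOn hab.le hF
    (hψeq.mono fun t ht => eq_neg_of_add_eq_zero_left ht)
  have hΨa : Ψ a = 0 := (hΨ (left_mem_Icc.2 hab.le)).trans hψ0.2.1
  have hΨb : Ψ b = 0 := (hΨ (right_mem_Icc.2 hab.le)).trans hψ0.2.2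
  have htangent : ∀ t ∈ Ioo a b, deriv g (u t) * (u t - v t) ≤ g (u t) - g (v t) := fun t ht => by
    rcases (hu.le_of_add_const hv hδ hg.continuous hq.locallyIntegrable
      (Ioo_subset_Icc_self ht)).eq_or_lt with hvu | hvu
    · simp [hvu]
    · have hslope := hconc.deriv_le_slope (hvpos t ht) (hupos t ht) hvu
        (hg.differentiable one_ne_zero _)
      rwa [slope_def_field, le_div_iff₀ (sub_pos.2 hvu)] at hslope
  have hle := hu.nonpos_of_le_secant hupos hv hvpos hδ hg.continuous hm hq hab hΨ'' hΨa hΨb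
    (c := fun t => deriv g (u t))
    (fun t ht _ => ⟨htangent t ht, by rw [hΨ (Ioo_subset_Icc_self ht)]; linarith⟩) ht
  have hge := hu.nonpos_of_le_secant hupos hv hvpos hδ hg.continuous hm hq hab hΨ''.neg
    (by rw [hΨa, neg_zero]) (by rw [hΨb, neg_zero]) (c := fun t => deriv g (u t))
    (fun t ht _ => ⟨htangent t ht, by rw [hΨ (Ioo_subset_Icc_self ht)]; linarith⟩) ht
  rw [← hΨ ht]
  linarith

end Nondegeneracy

section ClassicalSolution

variable {u u' u'' : ℝ → ℝ} {s : Set ℝ}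

namespace HasSecondDerivOn

theorem congr_of_isOpen {v : ℝ → ℝ} (hu : HasSecondDerivOn u u' u'' s) (hs : IsOpen s)
    (hvu : EqOn v u s) : HasSecondDerivOn v u' u'' s :=
  ⟨fun t ht => (hu.fst t ht).congr_of_eventuallyEq (hvu.eventuallyEq_of_mem (hs.mem_nhds ht)),
    hu.snd⟩

theorem deriv_deriv_eq (hu : HasSecondDerivOn u u' u'' s) (hs : IsOpen s) :
    EqOn (deriv (deriv u)) u'' s := fun t ht => by
  have hderiv : EqOn (deriv u) u' s := fun x hx => (hu.fst x hx).deriv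
  rw [(hderiv.eventuallyEq_of_mem (hs.mem_nhds ht)).deriv_eq, (hu.snd t ht).deriv]

theorem contDiffOn_two (hu : HasSecondDerivOn u u' u'' s) (hs : IsOpen s)
    (hcont : ContinuousOn u'' s) : ContDiffOn ℝ 2 u s := by
  have hsucc : ∀ {n : ℕ} {f f' : ℝ → ℝ}, (∀ t ∈ s, HasDerivAt f (f' t) t) →
      ContDiffOn ℝ n f' s → ContDiffOn ℝ (n + 1) f s := fun hf hf' =>
    (contDiffOn_succ_iff_deriv_of_isOpen hs).2
      ⟨fun t ht => (hf t ht).differentiableAt.differentiableWithinAt, by simp,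
        hf'.congr fun t ht => (hf t ht).deriv⟩
  exact_mod_cast hsucc (n := 1) hu.fst <| by
    exact_mod_cast hsucc (n := 0) hu.snd <| by exact_mod_cast contDiffOn_zero.2 hcont

end HasSecondDerivOn

theorem IsNonnegMinimizer.solvesPositiveBVP {g q : ℝ → ℝ} {a b : ℝ}
    (hu : IsNonnegMinimizer g q a b u) (hpos : ∀ t ∈ Ioo a b, 0 < u t) (hg : Continuous g)
    (hm : MonotoneOn g (Ici 0)) (hq : Continuous q) (hab : a < b) :
    SolvesPositiveBVP g q a b u := by
  obtain ⟨U, U', hU, hU''⟩ := hu.exists_hasSecondDerivOn hg hm hq hab hpos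
  have huc := (hu.hasL2Deriv hab.le).continuousOn
  have hu'' := (hU''.mono Ioo_subset_Icc_self).congr_of_isOpen isOpen_Ioo
    (hU.mono Ioo_subset_Icc_self).symm
  have hforce : ContinuousOn (fun t => q t - g (u t)) (Ioo a b) :=
    hq.continuousOn.sub (hg.comp_continuousOn (huc.mono Ioo_subset_Icc_self))
  refine ⟨huc, hu''.contDiffOn_two isOpen_Ioo hforce, fun t ht => ?_, hu.1.1.2.1, hu.1.1.2.2,
    hpos⟩
  rw [hu''.deriv_deriv_eq isOpen_Ioo ht, sub_add_cancel]

end ClassicalSolution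

section Decomposition

variable {f p : ℝ → ℝ} {A C T : ℝ}

/-- The mean of `f` over the window `[t, t + T]`; `HasAsymptoticAverage f A` says that it converges
to `A` uniformly in `t`. -/
noncomputable def movingAverage (T : ℝ) (f : ℝ → ℝ) (t : ℝ) : ℝ := 1 / T * ∫ s in t..(t + T), f s

theorem movingAverage_eq (hf : Continuous f) (T t : ℝ) :
    movingAverage T f t = 1 / T * (potential f (t + T) - potential f t) := by
  rw [movingAverage, potential_sub hf]

theorem hasDerivAt_movingAverage (hf : Continuous f) (T t : ℝ) :
    HasDerivAt (movingAverage T f) (1 / T * (f (t + T) - f t)) t := by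
  rw [funext (movingAverage_eq hf T)]
  exact (((hasDerivAt_potential hf _).comp_add_const t T).sub
    (hasDerivAt_potential hf t)).const_mul _

theorem continuous_movingAverage (hf : Continuous f) (T : ℝ) : Continuous (movingAverage T f) :=
  continuous_iff_continuousAt.2 fun t => (hasDerivAt_movingAverage hf T t).continuousAt

theorem abs_sub_movingAverage_le (hf : Continuous f) (hT : 0 < T) {K t : ℝ}
    (hK : ∀ s ∈ Icc t (t + T), |f t - f s| ≤ K) : |f t - movingAverage T f t| ≤ K := by
  have hmean : f t - movingAverage T f t = 1 / T * ∫ s in t..(t + T), (f t - f s) := by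
    rw [movingAverage, intervalIntegral.integral_sub intervalIntegrable_const
      (hf.intervalIntegrable _ _), intervalIntegral.integral_const, smul_eq_mul]
    field_simp
    ring
  have hle := intervalIntegral.norm_integral_le_of_norm_le_const (f := fun s => f t - f s)
    (a := t) (b := t + T) (C := K) fun s hs => hK s <| by
      rw [uIoc_of_le (by linarith)] at hs
      exact Ioc_subset_Icc_self hs
  rw [add_sub_cancel_left, abs_of_pos hT, Real.norm_eq_abs] at hle
  rw [hmean, abs_mul, abs_of_pos (one_div_pos.2 hT), one_div, inv_mul_le_iff₀ hT]
  linarith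

theorem abs_potential_sub_le (hf : Continuous f) (hC : ∀ t, |f t| ≤ C) (x y : ℝ) :
    |potential f x - potential f y| ≤ C * |x - y| := by
  rw [potential_sub hf]
  exact intervalIntegral.norm_integral_le_of_norm_le_const (f := f) (C := C) fun s _ => hC s

theorem memLp_top_of_continuous (hf : Continuous f) (hC : ∀ t, |f t| ≤ C) :
    MemLp f ∞ volume :=
  memLp_top_of_bound hf.aestronglyMeasurable C (ae_of_all _ hC)

theorem isDecomposition_movingAverage (hp : Continuous p) (hC : ∀ t, |p t| ≤ C) (hT : 0 < T)
    {ε η : ℝ} (hη : ∀ t, |movingAverage T p t - A| ≤ η) (hηε : η < ε / 2) :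
    IsDecomposition p A ε (movingAverage T p)
      (fun t => potential p t - movingAverage T (potential p) t) where
  memLp_fst := memLp_top_of_continuous (continuous_movingAverage hp T) (C := |A| + η) fun t => by
    have := abs_add_le A (movingAverage T p t - A)
    rw [add_sub_cancel] at this
    linarith [hη t]
  memLp_snd := by
    have hP := continuous_potential hp
    refine memLp_top_of_continuous (hP.sub (continuous_movingAverage hP T)) fun t =>
      abs_sub_movingAverage_le hP hT (K := C * T) fun s hs =>
        (abs_potential_sub_le hp hC t s).trans ?_
    refine mul_le_mul_of_nonneg_left ?_ ((abs_nonneg _).trans (hC 0))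
    rw [abs_sub_comm, abs_of_nonneg (sub_nonneg.2 hs.1)]
    linarith [hs.2]
  close := by
    have hη0 : 0 ≤ η := (abs_nonneg _).trans (hη 0)
    rw [eLpNorm_exponent_top]
    exact (eLpNormEssSup_le_of_ae_bound (ae_of_all _ hη)).trans_lt
      ((ENNReal.ofReal_lt_ofReal_iff (hη0.trans_lt hηε)).2 hηε)
  primitive s t := by
    have hderiv : ∀ x, HasDerivAt (fun t => potential p t - movingAverage T (potential p) t)
        (p x - movingAverage T p x) x := fun x => by
      rw [movingAverage_eq hp]
      exact (hasDerivAt_potential hp x).sub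
        (hasDerivAt_movingAverage (continuous_potential hp) T x)
    exact (intervalIntegral.integral_eq_sub_of_hasDerivAt (fun x _ => hderiv x)
      ((hp.sub (continuous_movingAverage hp T)).intervalIntegrable _ _)).symm

theorem exists_isDecompositionFamily (hp : Continuous p) (hC : ∀ t, |p t| ≤ C)
    (hA : HasAsymptoticAverage p A) : ∃ p₁ p₂, IsDecompositionFamily p A p₁ p₂ := by
  have hexists : ∀ ε, 0 < ε → ∃ T, 0 < T ∧ ∀ t, |movingAverage T p t - A| < ε / 4 := fun ε hε => by
    obtain ⟨T, hT, hT0⟩ := ((Metric.tendstoUniformly_iff.1 hA (ε / 4) (by linarith)).and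
      (eventually_gt_atTop 0)).exists
    exact ⟨T, hT0, fun t => (Real.dist_eq _ _).symm.trans_lt ((dist_comm _ _).trans_lt (hT t))⟩
  choose! T hT hclose using hexists
  exact ⟨_, _, fun ε hε => isDecomposition_movingAverage hp hC (hT ε hε.1)
    (fun t => (hclose ε hε.1 t).le) (by linarith [hε.1])⟩

end Decomposition

section ForcingClass

variable {p χ : ℝ → ℝ} {A δ : ℝ} {p₁ p₂ : ℝ → ℝ → ℝ}

theorem abs_intervalIntegral_le_integral_abs (hχ : Integrable χ volume) (s t : ℝ) :
    |∫ x in s..t, χ x| ≤ ∫ x, |χ x| :=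
  (intervalIntegral.norm_integral_le_integral_norm_uIoc (f := χ)).trans
    (setIntegral_le_integral hχ.norm (ae_of_all _ fun _ => norm_nonneg _))

theorem HasAsymptoticAverage.add_integrable (hA : HasAsymptoticAverage p A)
    (hp : LocallyIntegrable p volume) (hχ : Integrable χ volume) :
    HasAsymptoticAverage (fun t => p t + χ t) A := by
  have hlim : Tendsto (fun T : ℝ => 1 / T * ∫ x, |χ x|) atTop (𝓝 0) := by
    simpa using (tendsto_inv_atTop_zero (𝕜 := ℝ)).mul_const (∫ x, |χ x|)
  rw [HasAsymptoticAverage, Metric.tendstoUniformly_iff] at hA ⊢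
  intro η hη
  filter_upwards [hA (η / 2) (half_pos hη), hlim.eventually (gt_mem_nhds (half_pos hη)),
    eventually_gt_atTop 0] with T hpT hχT hT t
  have hp_lt := hpT t
  rw [dist_comm, Real.dist_eq] at hp_lt ⊢
  have hχ_le : |1 / T * ∫ x in t..(t + T), χ x| ≤ 1 / T * ∫ x, |χ x| := by
    rw [abs_mul, abs_of_pos (one_div_pos.2 hT)]
    exact mul_le_mul_of_nonneg_left (abs_intervalIntegral_le_integral_abs hχ _ _)
      (one_div_pos.2 hT).le
  rw [intervalIntegral.integral_add (intervalIntegrable_of_locallyIntegrable hp _ _)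
    hχ.intervalIntegrable, mul_add, add_sub_right_comm]
  exact (abs_add_le _ _).trans_lt (by linarith)

theorem IsDecomposition.add_integrable {q q₁ q₂ : ℝ → ℝ} {ε : ℝ}
    (h : IsDecomposition q A ε q₁ q₂) (hq : LocallyIntegrable q volume)
    (hχ : Integrable χ volume) :
    IsDecomposition (fun t => q t + χ t) A ε q₁ (fun t => q₂ t + ∫ x in (0 : ℝ)..t, χ x) where
  memLp_fst := h.memLp_fst
  memLp_snd := h.memLp_snd.add <| memLp_top_of_continuous
    (intervalIntegral.continuous_primitive (fun _ _ => hχ.intervalIntegrable) 0)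
    (abs_intervalIntegral_le_integral_abs hχ 0)
  close := h.close
  primitive s t := by
    have hqi := intervalIntegrable_of_locallyIntegrable hq s t
    have hq₁i := intervalIntegrable_of_locallyIntegrable (h.memLp_fst.locallyIntegrable le_top) s t
    calc q₂ t + (∫ x in (0 : ℝ)..t, χ x) - (q₂ s + ∫ x in (0 : ℝ)..s, χ x)
        = (q₂ t - q₂ s) + ((∫ x in (0 : ℝ)..t, χ x) - ∫ x in (0 : ℝ)..s, χ x) := by ring
      _ = (∫ x in s..t, (q x - q₁ x)) + ∫ x in s..t, χ x := by
          rw [h.primitive, intervalIntegral.integral_interval_sub_left hχ.intervalIntegrable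
            hχ.intervalIntegrable]
      _ = ∫ x in s..t, (q x + χ x - q₁ x) := by
          rw [← intervalIntegral.integral_add (hqi.sub hq₁i) hχ.intervalIntegrable]
          exact intervalIntegral.integral_congr fun x _ => by ring

theorem eLpNorm_top_add_lt_add_one {X : Type*} [MeasurableSpace X] {μ : Measure X} {f h : X → ℝ}
    (hf : MemLp f ∞ μ) (hh : AEStronglyMeasurable h μ) {e : ℝ} (he : e < 1)
    (hhe : ∀ x, |h x| ≤ e) : eLpNorm (fun x => f x + h x) ∞ μ < eLpNorm f ∞ μ + 1 := by
  refine (eLpNorm_add_le hf.1 hh le_top).trans_lt (ENNReal.add_lt_add_left hf.2.ne ?_)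
  rw [eLpNorm_exponent_top]
  exact (eLpNormEssSup_le_of_ae_bound (ae_of_all _ hhe)).trans_lt
    (ENNReal.ofReal_lt_one.2 he)

theorem add_mem_forcingClass (hp : MemLp p ∞ volume) (hA : HasAsymptoticAverage p A)
    (hdec : IsDecompositionFamily p A p₁ p₂) (hχ : Integrable χ volume) (hδ : ∀ t, |χ t| ≤ δ)
    (hδ1 : δ < 1) (hχ1 : ∫ t, |χ t| < 1) : (fun t => p t + χ t) ∈ forcingClass p A p₂ := by
  have hpl := hp.locallyIntegrable le_top
  refine ⟨hp.add (memLp_top_of_bound hχ.aestronglyMeasurable δ (ae_of_all _ hδ)),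
    eLpNorm_top_add_lt_add_one hp hχ.aestronglyMeasurable hδ1 hδ, hA.add_integrable hpl hχ,
    fun ε hε => ⟨_, _, (hdec ε hε).add_integrable hpl hχ, ?_⟩⟩
  exact eLpNorm_top_add_lt_add_one (hdec ε hε).memLp_snd
    (intervalIntegral.continuous_primitive
      (fun _ _ => hχ.intervalIntegrable) 0).aestronglyMeasurable
    hχ1 (abs_intervalIntegral_le_integral_abs hχ 0)

theorem self_mem_forcingClass (hp : MemLp p ∞ volume) (hA : HasAsymptoticAverage p A)
    (hdec : IsDecompositionFamily p A p₁ p₂) : p ∈ forcingClass p A p₂ := by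
  simpa using add_mem_forcingClass hp hA hdec (χ := 0) (integrable_zero _ _ _) (δ := 0)
    (by simp) one_pos (by simp)

theorem exists_eqOn_add_const_mem_forcingClass (hp : MemLp p ∞ volume)
    (hA : HasAsymptoticAverage p A) (hdec : IsDecompositionFamily p A p₁ p₂) (a b : ℝ) :
    ∃ δ > 0, ∃ q ∈ forcingClass p A p₂, EqOn q (fun t => p t + δ) (Icc a b) := by
  set δ := 1 / (2 + |b - a|)
  have hδ : 0 < δ := by positivity
  have hδ1 : δ < 1 := by
    rw [div_lt_one (by positivity)]
    linarith [abs_nonneg (b - a)]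
  have hδab : max (b - a) 0 * δ < 1 := by
    rw [mul_one_div, div_lt_one (by positivity)]
    exact max_lt (by linarith [le_abs_self (b - a)]) (by positivity)
  set χ := (Icc a b).indicator fun _ => δ
  have hχ0 : ∀ t, |χ t| = χ t := fun t => abs_of_nonneg (indicator_nonneg (fun _ _ => hδ.le) t)
  refine ⟨δ, hδ, _, add_mem_forcingClass hp hA hdec (χ := χ)
    ((integrable_indicator_iff measurableSet_Icc).2 (integrableOn_const (by simp)))
    (fun t => (hχ0 t).trans_le (indicator_le_self' (fun _ _ => hδ.le) t)) hδ1 ?_,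
    fun t ht => by simp [χ, indicator_of_mem ht]⟩
  simp only [hχ0]
  rwa [integral_indicator_const _ measurableSet_Icc, Real.volume_real_Icc, smul_eq_mul]

end ForcingClass

section BoundedConcave

variable {g : ℝ → ℝ} {l : ℝ}

theorem monotoneOn_Ioi_of_concaveOn_of_tendsto (hconc : ConcaveOn ℝ (Ioi 0) g)
    (hlim : Tendsto g atTop (𝓝 l)) : MonotoneOn g (Ioi 0) := by
  intro x hx y hy hxy
  by_contra! hlt
  have hxy : x < y := hxy.lt_of_ne (by rintro rfl; exact hlt.false)
  set m := (g y - g x) / (y - x)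
  have hneg : m < 0 := div_neg_of_neg_of_pos (sub_neg.2 hlt) (sub_pos.2 hxy)
  have hline : ∀ᶠ z in atTop, g z ≤ g y + m * (z - y) := by
    filter_upwards [eventually_gt_atTop y] with z hz
    have hslope := hconc.slope_anti_adjacent hx (lt_trans hy hz) hxy hz
    rw [div_le_iff₀ (sub_pos.2 hz)] at hslope
    linarith
  have hbot : Tendsto (fun z => g y + m * (z - y)) atTop atBot :=
    tendsto_atBot_add_const_left _ _ <|
      (tendsto_atTop_add_const_right _ (-y) tendsto_id).const_mul_atTop_of_neg hneg
  exact not_tendsto_nhds_of_tendsto_atBot (tendsto_atBot_mono' _ hline hbot) l hlim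

theorem monotoneOn_Ici_of_concaveOn_of_tendsto (hg : Continuous g)
    (hconc : ConcaveOn ℝ (Ioi 0) g) (hlim : Tendsto g atTop (𝓝 l)) : MonotoneOn g (Ici 0) := by
  intro x hx y _ hxy
  obtain rfl | hlt := hxy.eq_or_lt
  · rfl
  have hsub : Ioo x y ⊆ {z | g z ≤ g y} := fun z hz =>
    have hz0 : 0 < z := (mem_Ici.1 hx).trans_lt hz.1
    monotoneOn_Ioi_of_concaveOn_of_tendsto hconc hlim hz0 (hz0.trans hz.2) hz.2.le
  have hclosure := closure_minimal hsub (isClosed_le hg continuous_const)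
  rw [closure_Ioo hlt.ne] at hclosure
  exact hclosure (left_mem_Icc.2 hxy)

theorem exists_abs_le_of_monotoneOn_of_tendsto (hm : MonotoneOn g (Ici 0))
    (hlim : Tendsto g atTop (𝓝 l)) : ∃ C, ∀ s, 0 ≤ s → |g s| ≤ C := by
  refine ⟨max |g 0| |l|, fun s hs => abs_le_max_abs_abs (hm self_mem_Ici hs hs) ?_⟩
  refine ge_of_tendsto hlim ?_
  filter_upwards [eventually_ge_atTop s] with x hx using hm hs (hs.trans hx) hx

end BoundedConcave

section Uniqueness

variable {g p : ℝ → ℝ} {A L a b : ℝ} {p₁ p₂ : ℝ → ℝ → ℝ}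

theorem exists_pos_minimizer_add_const {C : ℝ} (hg : Continuous g)
    (hC : ∀ s, 0 ≤ s → |g s| ≤ C) (hp : MemLp p ∞ volume) (hA : HasAsymptoticAverage p A)
    (hdec : IsDecompositionFamily p A p₁ p₂) (hL : IsThreshold g (forcingClass p A p₂) L)
    (hLab : L ≤ b - a) :
    ∃ δ > 0, ∃ v, IsNonnegMinimizer g (fun t => p t + δ) a b v ∧ ∀ t ∈ Ioo a b, 0 < v t := by
  have hab : a ≤ b := sub_nonneg.1 (hL.1.le.trans hLab)
  obtain ⟨δ, hδ, q, hq, hqδ⟩ := exists_eqOn_add_const_mem_forcingClass hp hA hdec a b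
  obtain ⟨v, hv⟩ := exists_isNonnegMinimizer (q := fun t => p t + δ) hab hg hC
    ((hp.add (memLp_top_const δ)).locallyIntegrable le_top)
  exact ⟨δ, hδ, v, hv, hL.2 a b hLab q hq v (hv.congr_force hab hqδ.symm)⟩

end Uniqueness

end DualNehari

theorem proposition5_general (g : ℝ → ℝ) (hg : ContDiff ℝ 1 g) (hconc : ConcaveOn ℝ (Ioi 0) g)
    (gplus : ℝ) (hgplus : Tendsto g atTop (𝓝 gplus))
    (p : ℝ → ℝ) (hpc : Continuous p) (hpb : ∃ C : ℝ, ∀ t, |p t| ≤ C)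
    (A : ℝ) (hA : HasAsymptoticAverage p A) (hAplus : A < gplus) :
    (∃ p₁ p₂ : ℝ → ℝ → ℝ, IsDecompositionFamily p A p₁ p₂) ∧
    ∀ p₁ p₂ : ℝ → ℝ → ℝ, IsDecompositionFamily p A p₁ p₂ →
      (∃ L : ℝ, IsThreshold g (forcingClass p A p₂) L) ∧
      ∀ L : ℝ, IsThreshold g (forcingClass p A p₂) L → ∀ a b : ℝ, L ≤ b - a →
        ∃ u : ℝ → ℝ, IsNonnegMinimizer g p a b u ∧
          (∀ v : ℝ → ℝ, IsNonnegMinimizer g p a b v → EqOn v u (Icc a b)) ∧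
          SolvesPositiveBVP g p a b u ∧ IsNondegenerate g a b u := by
  obtain ⟨Cp, hCp⟩ := hpb
  have hgc := hg.continuous
  have hm := monotoneOn_Ici_of_concaveOn_of_tendsto hgc hconc hgplus
  obtain ⟨C, hC⟩ := exists_abs_le_of_monotoneOn_of_tendsto hm hgplus
  have hp := memLp_top_of_continuous hpc hCp
  refine ⟨exists_isDecompositionFamily hpc hCp hA, fun p₁ p₂ hdec =>
    ⟨exists_isThreshold hgc hm hC hgplus hAplus hp fun ε hε => (hdec ε hε).memLp_snd,
    fun L hL a b hLab => ?_⟩⟩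
  have hab : a < b := sub_pos.1 (hL.1.trans_le hLab)
  have hpos := hL.2 a b hLab p (self_mem_forcingClass hp hA hdec)
  obtain ⟨δ, hδ, v, hv, hvpos⟩ := exists_pos_minimizer_add_const hgc hC hp hA hdec hL hLab
  have hle : ∀ w w', IsNonnegMinimizer g p a b w → IsNonnegMinimizer g p a b w' →
      ∀ t ∈ Icc a b, w' t ≤ w t := fun w w' hw hw' t ht =>
    hw.le_of_pos (hpos w hw) hw' (hpos w' hw') hv hvpos hδ hgc hm hconc hpc hab ht
  obtain ⟨u, hu⟩ := exists_isNonnegMinimizer hab.le hgc hC (hp.locallyIntegrable le_top)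
  exact ⟨u, hu, fun w hw t ht => le_antisymm (hle u w hu hw t ht) (hle w u hw hu t ht),
    hu.solvesPositiveBVP (hpos u hu) hgc hm hpc hab,
    hu.isNondegenerate_of_pos (hpos u hu) hv hvpos hδ hg hm hconc hpc hab⟩

theorem proposition5 (g : ℝ → ℝ) (hg : IsSaturating g)
    (gminus gplus : ℝ) (hgminus : Tendsto g atBot (𝓝 gminus)) (hgplus : Tendsto g atTop (𝓝 gplus))
    (p : ℝ → ℝ) (hpc : Continuous p) (hpb : ∃ C : ℝ, ∀ t, |p t| ≤ C)
    (A : ℝ) (hA : HasAsymptoticAverage p A) (hAminus : gminus < A) (hAplus : A < gplus) :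
    (∃ p₁ p₂ : ℝ → ℝ → ℝ, IsDecompositionFamily p A p₁ p₂) ∧
    ∀ p₁ p₂ : ℝ → ℝ → ℝ, IsDecompositionFamily p A p₁ p₂ →
      (∃ L : ℝ, IsThreshold g (forcingClass p A p₂) L) ∧
      ∀ L : ℝ, IsThreshold g (forcingClass p A p₂) L → ∀ a b : ℝ, L ≤ b - a →
        ∃ u : ℝ → ℝ, IsNonnegMinimizer g p a b u ∧
          (∀ v : ℝ → ℝ, IsNonnegMinimizer g p a b v → EqOn v u (Icc a b)) ∧
          SolvesPositiveBVP g p a b u ∧ IsNondegenerate g a b u :=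
  proposition5_general g (hg.contDiff.of_le one_le_two) hg.strictConcave.concaveOn gplus hgplus
    p hpc hpb A hA hAplus
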